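/- Let $G=(V,E)$ be an infinite, connected, locally finite, vertex-transitive graph that is transient, i.e. simple random walk started at a vertex $x$ has a finite expected number of visits to $x$. Consider activated random walk on $G$ with sleep rate $\lambda>0$ and density $\mu\in[0,1]$: initially each vertex independently holds one particle with probability $\mu$ and none otherwise, and all particles are active. Each active particle independently jumps at rate $1$ to a uniformly chosen neighbour, and at rate $\lambda$ it tries to fall asleep, which succeeds if and only if it is the only particle at its vertex. A sleeping particle does not move, and becomes active again as soon as another particle jumps to its vertex. The process \emph{fixates} if every vertex holds no active particle from some finite (random) time on, and it is \emph{active} otherwise. Let $$\mu_c(\lambda)=\inf\{\mu\in[0,1] : P(\text{the process with sleep rate }\lambda\text{ and density }\mu\text{ is active})>0\},$$ where the infimum of the empty set is $1$. Then $$\lim_{\lambda\downarrow 0}\mu_c(\lambda)=0,\qquad\text{and more precisely}\qquad \limsup_{\lambda\downarrow 0}\frac{\mu_c(\lambda)}{\lambda^{1/4}}<\infty .$$ In particular, there is $\lambda_0>0$ such that $\mu_c(\lambda)<1$ for all $\lambda\in(0,\lambda_0)$. -/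

import Mathlib

open MeasureTheory ProbabilityTheory Filter Topology

namespace ARW

noncomputable section

/-! ### Graphs and simple random walk -/

/-- Any vertex can be mapped to any other one by a graph automorphism. -/
def VertexTransitive {V : Type*} (G : SimpleGraph V) : Prop :=
  ∀ u v : V, ∃ φ : G ≃g G, φ u = v

open scoped Classical in
/-- The probability that simple random walk on `G` started at `x` is at `y` after `n` steps. -/
def walkProb {V : Type*} (G : SimpleGraph V) [G.LocallyFinite] : ℕ → V → V → ℝ
  | 0, x, y => if x = y then 1 else 0
  | n + 1, x, y => (∑ z ∈ G.neighborFinset x, walkProb G n z y) / G.degree x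

/-- `G` is transient: simple random walk started at a vertex `x` has a finite expected number of
visits to `x`. -/
def Transient {V : Type*} (G : SimpleGraph V) [G.LocallyFinite] : Prop :=
  ∀ x : V, Summable fun n : ℕ => walkProb G n x x

/-! ### Configurations and instructions -/

/-- The state of a vertex: either it holds exactly one particle, which is sleeping, or it holds `n`
particles, all of them active (`active 0` is the empty vertex). -/
inductive SiteState : Type
  | sleeping : SiteState
  | active (n : ℕ) : SiteState

namespace SiteState

/-- The number of active particles. -/
def numActive : SiteState → ℕ
  | sleeping => 0
  | active n => n

/-- A vertex is stable if it holds no active particle. -/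
def Stable (s : SiteState) : Prop := s.numActive = 0

/-- An active particle arrives; a sleeping particle, if there is one, is woken up. -/
def arrive : SiteState → SiteState
  | sleeping => active 2
  | active n => active (n + 1)

/-- An active particle leaves. -/
def leave : SiteState → SiteState
  | sleeping => sleeping
  | active n => active (n - 1)

/-- An active particle tries to fall asleep, which succeeds only if it is alone. -/
def trySleep : SiteState → SiteState
  | active 1 => sleeping
  | s => s

end SiteState

/-- The state of all vertices. -/
abbrev Config (V : Type*) := V → SiteState

/-- What an active particle is told to do: try to fall asleep, or jump to the vertex `y`. -/
inductive Instruction (V : Type*) : Type _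
  | sleep : Instruction V
  | jump (y : V) : Instruction V

instance (V : Type*) : MeasurableSpace (Instruction V) := ⊤

open scoped Classical in
/-- Perform an instruction at the vertex `x`. -/
def perform {V : Type*} (x : V) : Instruction V → Config V → Config V
  | .sleep, η => Function.update η x (η x).trySleep
  | .jump y, η =>
      if 1 ≤ (η x).numActive then
        let η' := Function.update η x (η x).leave
        Function.update η' y (η' y).arrive
      else η

/-! ### The source of randomness -/

/-- A sample point: the set of vertices that initially hold a particle, for every vertex `x` the
stack `j ↦ τ (x, j)` of instructions to be used at `x`, and for every vertex `x` and every `i`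
the waiting times `n ↦ ξ (x, i, n)` between successive rings of the `i`-th clock at `x`. -/
abbrev Sample (V : Type*) :=
  (V → Bool) × (V × ℕ → Instruction V) × (V × ℕ × ℕ → ℝ)

/-- The law of one instruction at `x`: sleep with probability `lam / (1 + lam)`, and a jump to
each of the `d` neighbours of `x` with probability `1 / (d * (1 + lam))`. -/
def instructionLaw {V : Type*} (G : SimpleGraph V) [G.LocallyFinite] (lam : ℝ) (x : V) :
    Measure (Instruction V) :=
  ENNReal.ofReal (lam / (1 + lam)) • Measure.dirac Instruction.sleep +
    ∑ y ∈ G.neighborFinset x,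
      ENNReal.ofReal (1 / (G.degree x * (1 + lam))) • Measure.dirac (Instruction.jump y)

/-- The joint law: all coordinates are independent, each vertex initially holds a particle with
probability `μ`, instructions have the law above, and the waiting times are exponential of rate
`1 + lam`, so that each clock `(x, i)` rings at the points of a Poisson process of that rate. -/
def sampleLaw {V : Type*} (G : SimpleGraph V) [G.LocallyFinite] (lam : ℝ) (μ : unitInterval) :
    Measure (Sample V) :=
  (Measure.infinitePi fun _ : V => bernoulliMeasure true false μ).prod
    ((Measure.infinitePi fun p : V × ℕ => instructionLaw G lam p.1).prod
      (Measure.infinitePi fun _ : V × ℕ × ℕ => expMeasure (1 + lam)))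

/-- Initially all particles are active. -/
def initialConfig {V : Type*} (ω : Sample V) : Config V :=
  fun x => if ω.1 x then .active 1 else .active 0

/-- The time of the `n`-th ring (`n = 0, 1, …`) of the `i`-th clock at `x`. -/
def ringTime {V : Type*} (ω : Sample V) (x : V) (i n : ℕ) : ℝ :=
  ∑ k ∈ Finset.range (n + 1), ω.2.2 (x, i, k)

/-! ### The dynamics in a finite set of vertices

Whenever a clock `(x, i)` with `x ∈ Λ` rings and `x` holds more than `i` active particles, the next
instruction of the stack at `x` is performed. Thus, when `x` holds `k` active particles,
instructions are used at `x` at total rate `k * (1 + lam)`: each active particle jumps at rate `1`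
to a uniform neighbour and tries to fall asleep at rate `lam`. Particles that leave `Λ` are frozen
for ever. -/

/-- The configuration, the number of instructions used so far at each vertex, and the current
time. -/
structure Stage (V : Type*) where
  config : Config V
  used : V → ℕ
  time : EReal

/-- The first time after `S.time` at which a clock belonging to an active particle in `Λ` rings;
it is `⊤` if there is no active particle in `Λ`. -/
def nextRing {V : Type*} (ω : Sample V) (Λ : Finset V) (S : Stage V) : EReal :=
  sInf {r : EReal | S.time < r ∧
    ∃ x ∈ Λ, ∃ i < (S.config x).numActive, ∃ n : ℕ, r = (ringTime ω x i n : EReal)}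

open scoped Classical in
/-- Go to the next ring and perform the next instruction of the stack at the vertex that rings.
(Almost surely no two clocks ring at the same time, so the choice of the vertex is no choice.) -/
def nextStage {V : Type*} (ω : Sample V) (Λ : Finset V) (S : Stage V) : Stage V :=
  if h : ∃ x ∈ Λ, ∃ i < (S.config x).numActive, ∃ n : ℕ,
      nextRing ω Λ S = (ringTime ω x i n : EReal) then
    { config := perform h.choose (ω.2.1 (h.choose, S.used h.choose)) S.config
      used := Function.update S.used h.choose (S.used h.choose + 1)
      time := nextRing ω Λ S }
  else
    { S with time := nextRing ω Λ S }

/-- The stage after `k` instructions have been used in `Λ`, if `Λ` is not stable before; once `Λ` is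
stable, the time is `⊤` and nothing changes any more. -/
def stage {V : Type*} (ω : Sample V) (Λ : Finset V) (k : ℕ) : Stage V :=
  (nextStage ω Λ)^[k] { config := initialConfig ω, used := fun _ => 0, time := 0 }

/-- The configuration at time `t` of the dynamics in `Λ`. -/
def finiteARW {V : Type*} (ω : Sample V) (Λ : Finset V) (t : ℝ) : Config V :=
  (stage ω Λ (sSup {k : ℕ | (stage ω Λ k).time ≤ (t : EReal)})).config

/-! ### The process on the whole graph -/

/-- `ζ` is the trajectory of activated random walk on the whole graph: the limit of the
trajectories in finite sets `Λ ↑ V`, where on every bounded time interval the trajectory at any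
given vertex agrees with that in `Λ` once `Λ` is large enough. (Almost surely such a limit exists;
it is clearly unique for times `t ≥ 0`.) -/
def IsARW {V : Type*} (ω : Sample V) (ζ : ℝ → Config V) : Prop :=
  ∀ (x : V) (t : ℝ), ∀ᶠ Λ : Finset V in atTop, ∀ s ∈ Set.Icc 0 t, finiteARW ω Λ s x = ζ s x

/-- Activated random walk fixates: at every vertex, from some time on there is no active
particle. -/
def Fixates {V : Type*} (ω : Sample V) : Prop :=
  ∃ ζ : ℝ → Config V, IsARW ω ζ ∧ ∀ x : V, ∃ T : ℝ, 0 ≤ T ∧ ∀ t : ℝ, T ≤ t → (ζ t x).Stable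

/-- Activated random walk is active if it does not fixate. -/
def IsActive {V : Type*} (ω : Sample V) : Prop := ¬ Fixates ω

/-- The critical density at sleep rate `lam`: the infimum of the densities `μ ∈ [0, 1]` for which
activated random walk is active with positive probability. The infimum is taken in `[0, 1]`, so
that it is `1` if there is no such density. -/
def criticalDensity {V : Type*} (G : SimpleGraph V) [G.LocallyFinite] (lam : ℝ) : ℝ :=
  ((sInf {μ : unitInterval | 0 < sampleLaw G lam μ {ω | IsActive ω}} : unitInterval) : ℝ)

end

end ARW

/-! Let g be the expected number of visits of simple random walk to its starting point, finite by
transience. The proof shows that density 2 * lam * g already gives an active process as soon as it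
is at most 1 (`criticalDensity_le`). This linear bound implies all three claims.

Since the randomness sits in stacks of instructions, the clocks can be forgotten: the dynamics is a
legal list of topplings. Topplings at different active sites commute, which yields the least action
principle `Legal.count_le`. By it, fixation bounds the number of topplings at `o` over all legal
lists (`Fixates.exists_count_le`). So it suffices that with positive probability there is no such
bound (`sampleLaw_unbounded_topplings_pos`).

Fix a finite `Λ` containing `o`, let `green` be the Green function of the walk killed outside `Λ`,
and let S be its total mass. The potential, the sum of `green` over all particles, drops in mean by
1 / (1 + lam) at each toppling at `o` and is preserved in mean by all others. So the mean number of
topplings at `o` is at least 1 + lam times the initial potential minus that of the sleepers left at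
the end, up to an error from stopping early (`sum_card_green_le`).

Sleepers are rare: a site `x` ends up asleep with probability at most lam * g
(`stabProb_sleeping_le`). Topple first while always holding one particle at `x`. The further
topplings at `x` are on average no more than one extra particle can cause, (1 + lam) * `green G Λ x
x`, and each is a sleep instruction with probability lam / (1 + lam).

At density 2 * lam * g the sleepers thus absorb at most half of the initial mean potential, and the
mean number of topplings at `o` is at least of order lam * g * S. Adding particles one at a time
bounds the second moment by a constant times S ^ 2 (`meanSqVisits_particles_le`). The second moment
method gives order S topplings with a probability bounded below independently of `Λ`, and S is
unbounded (`exists_le_sum_green`). -/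

namespace ARW

noncomputable section

open scoped Classical

/-! ### Instructions act sitewise -/

namespace SiteState

/-- The number of particles, active or sleeping. -/
def card : SiteState → ℕ
  | sleeping => 1
  | active n => n

/-- Site states ordered by activity: empty, then one sleeping particle, then active particles. -/
def rank : SiteState → ℕ
  | sleeping => 1
  | active 0 => 0
  | active (n + 1) => n + 2

theorem rank_arrive_mono {a a' : SiteState} (h : a.rank ≤ a'.rank) :
    a.arrive.rank ≤ a'.arrive.rank := by
  rcases a with _ | _ | n <;> rcases a' with _ | _ | m <;> simp_all [rank, arrive]

/-- Activity of `a` is essential: `leave` fixes `sleeping` but sends the larger state `active 1` to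
the smaller state `active 0`. -/
theorem rank_active_mono {a a' : SiteState} (h : a.rank ≤ a'.rank) (ha : 1 ≤ a.numActive) :
    a.numActive ≤ a'.numActive ∧ a.leave.rank ≤ a'.leave.rank ∧
      a.trySleep.rank ≤ a'.trySleep.rank := by
  rcases a with _ | _ | _ | n <;> rcases a' with _ | _ | _ | m <;>
    simp_all [rank, leave, trySleep, numActive]

end SiteState

/-- The effect at the site `w` of performing an instruction at an active site `x`. -/
def siteEffect {V : Type*} (x : V) (i : Instruction V) (w : V) (a : SiteState) : SiteState :=
  match i with
  | .sleep => if w = x then a.trySleep else a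
  | .jump y => if w = y then (if w = x then a.leave else a).arrive else if w = x then a.leave else a

/-- An instruction acts on each site separately, so commutation and monotonicity reduce to case
checks on a single `SiteState`. -/
theorem perform_apply {V : Type*} {x : V} {η : Config V} (h : 1 ≤ (η x).numActive)
    (i : Instruction V) (w : V) : perform x i η w = siteEffect x i w (η w) := by
  rcases i with _ | y
  · simp only [perform, siteEffect, Function.update_apply]
    split_ifs with h1
    · rw [h1]
    · rfl
  · simp only [perform, siteEffect, if_pos h, Function.update_apply]
    by_cases h1 : w = y
    · subst h1
      by_cases h2 : w = x
      · subst h2; simp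
      · simp [h2]
    · by_cases h2 : w = x
      · subst h2; simp [h1]
      · simp [h1, h2]

/-- The delicate case is a sleep attempt against an arrival. In one order `active 1` falls asleep
and is woken to `active 2`; in the other it becomes `active 2` first and the attempt fails. -/
theorem siteEffect_comm {V : Type*} {y z : V} (hyz : y ≠ z) (i j : Instruction V) (w : V)
    {a : SiteState} (hy : w = y → 1 ≤ a.numActive) (hz : w = z → 1 ≤ a.numActive) :
    siteEffect y j w (siteEffect z i w a) = siteEffect z i w (siteEffect y j w a) := by
  rcases i with _ | u <;> rcases j with _ | v <;> simp only [siteEffect] <;>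
    rcases a with _ | _ | _ | n <;> split_ifs <;>
    simp_all [SiteState.arrive, SiteState.leave, SiteState.trySleep, SiteState.numActive]

theorem numActive_le_siteEffect {V : Type*} {x w : V} (h : w ≠ x) (i : Instruction V)
    (a : SiteState) : a.numActive ≤ (siteEffect x i w a).numActive := by
  rcases i with _ | u <;> simp only [siteEffect] <;> rcases a with _ | n <;> split_ifs <;>
    simp_all [SiteState.arrive, SiteState.numActive]

theorem numActive_le_perform {V : Type*} {x w : V} (h : w ≠ x) (i : Instruction V)
    {η : Config V} (hx : 1 ≤ (η x).numActive) :
    (η w).numActive ≤ (perform x i η w).numActive := by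
  rw [perform_apply hx]
  exact numActive_le_siteEffect h i _

theorem perform_comm {V : Type*} {y z : V} (hyz : y ≠ z) (i j : Instruction V) {η : Config V}
    (hy : 1 ≤ (η y).numActive) (hz : 1 ≤ (η z).numActive) :
    perform y j (perform z i η) = perform z i (perform y j η) := by
  funext w
  rw [perform_apply (hy.trans (numActive_le_perform hyz i hz)), perform_apply hz,
    perform_apply (hz.trans (numActive_le_perform hyz.symm j hy)), perform_apply hy]
  exact siteEffect_comm hyz i j w (fun h => h ▸ hy) (fun h => h ▸ hz)

/-! ### Toppling with stacks of instructions -/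

/-- A stack of instructions at every site. -/
abbrev Stacks (V : Type*) := V × ℕ → Instruction V

/-- Drop the first instruction at `z`. -/
def tailAt {V : Type*} (z : V) (τ : Stacks V) : Stacks V :=
  fun p => if p.1 = z then τ (p.1, p.2 + 1) else τ p

/-- Put a new first instruction at `z`. -/
def consAt {V : Type*} (z : V) (i : Instruction V) (τ : Stacks V) : Stacks V :=
  fun p => if p.1 = z then (match p.2 with
    | 0 => i
    | n + 1 => τ (p.1, n)) else τ p

theorem tailAt_consAt {V : Type*} (z : V) (i : Instruction V) (τ : Stacks V) :
    tailAt z (consAt z i τ) = τ := by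
  funext ⟨w, n⟩
  simp only [tailAt, consAt]
  split_ifs <;> rfl

theorem consAt_self {V : Type*} (z : V) (i : Instruction V) (τ : Stacks V) :
    consAt z i τ (z, 0) = i := by simp [consAt]

theorem tailAt_comm {V : Type*} (y z : V) (τ : Stacks V) :
    tailAt y (tailAt z τ) = tailAt z (tailAt y τ) := by
  funext ⟨w, n⟩
  simp only [tailAt]
  split_ifs <;> rfl

theorem tailAt_apply_of_ne {V : Type*} {y z : V} (h : y ≠ z) (τ : Stacks V) (n : ℕ) :
    tailAt z τ (y, n) = τ (y, n) := by simp [tailAt, h]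

/-- Perform the first instruction at `z` and drop it. -/
def topple {V : Type*} (z : V) (s : Config V × Stacks V) : Config V × Stacks V :=
  (perform z (s.2 (z, 0)) s.1, tailAt z s.2)

theorem topple_consAt {V : Type*} (z : V) (i : Instruction V) (η : Config V) (τ : Stacks V) :
    topple z (η, consAt z i τ) = (perform z i η, τ) := by
  simp only [topple, consAt_self, tailAt_consAt]

theorem topple_comm {V : Type*} {y z : V} (hyz : y ≠ z) {s : Config V × Stacks V}
    (hy : 1 ≤ (s.1 y).numActive) (hz : 1 ≤ (s.1 z).numActive) :
    topple y (topple z s) = topple z (topple y s) := by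
  simp only [topple, tailAt_apply_of_ne hyz, tailAt_apply_of_ne hyz.symm, tailAt_comm y z]
  rw [perform_comm hyz _ _ hy hz]

/-- Topple the sites of a list in order. -/
def run {V : Type*} : List V → Config V × Stacks V → Config V × Stacks V
  | [], s => s
  | z :: α, s => run α (topple z s)

/-- A list of topplings is legal when every site is in `Λ` and holds more than `b` active particles
at the time of the toppling. -/
def Legal {V : Type*} (Λ : Set V) (b : V → ℕ) : List V → Config V × Stacks V → Prop
  | [], _ => True
  | z :: α, s => (z ∈ Λ ∧ b z < (s.1 z).numActive) ∧ Legal Λ b α (topple z s)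

/-! ### Commutation of topplings and the least action principle -/

section Abelian

variable {V : Type*} {Λ : Set V} {b : V → ℕ}

theorem run_append (α β : List V) (s : Config V × Stacks V) :
    run (α ++ β) s = run β (run α s) := by
  induction α generalizing s with
  | nil => rfl
  | cons z α ih => exact ih _

theorem legal_append (α β : List V) (s : Config V × Stacks V) :
    Legal Λ b (α ++ β) s ↔ Legal Λ b α s ∧ Legal Λ b β (run α s) := by
  induction α generalizing s with
  | nil => simp [Legal, run]
  | cons z α ih => simp [Legal, run, ih, and_assoc]

theorem Legal.mono {Λ' : Set V} {b' : V → ℕ} (hΛ : Λ ⊆ Λ') (hb : b' ≤ b) {α : List V}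
    {s : Config V × Stacks V} (h : Legal Λ b α s) : Legal Λ' b' α s := by
  induction α generalizing s with
  | nil => trivial
  | cons z α ih => exact ⟨⟨hΛ h.1.1, (hb z).trans_lt h.1.2⟩, ih h.2⟩

theorem Legal.mem {α : List V} {s : Config V × Stacks V} (h : Legal Λ b α s) {z : V}
    (hz : z ∈ α) : z ∈ Λ := by
  induction α generalizing s with
  | nil => simp at hz
  | cons y α ih =>
    rcases List.mem_cons.1 hz with rfl | hz
    · exact h.1.1
    · exact ih h.2 hz

/-- A toppling at an active site commutes with a legal list that avoids the site. -/
theorem Legal.topple_of_notMem {α : List V} {s : Config V × Stacks V} (h : Legal Λ b α s) {z : V}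
    (hz : z ∉ α) (ha : 1 ≤ (s.1 z).numActive) :
    Legal Λ b α (topple z s) ∧ run α (topple z s) = topple z (run α s) ∧
      1 ≤ ((run α s).1 z).numActive := by
  induction α generalizing s with
  | nil => exact ⟨trivial, rfl, ha⟩
  | cons y α ih =>
    have hyz : y ≠ z := fun h => hz (h ▸ List.mem_cons_self)
    have hy : 1 ≤ (s.1 y).numActive := by have := h.1.2; omega
    have hz' : 1 ≤ ((topple y s).1 z).numActive :=
      ha.trans (numActive_le_perform hyz.symm _ hy)
    obtain ⟨h1, h2, h3⟩ := ih h.2 (fun h => hz (List.mem_cons_of_mem _ h)) hz'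
    have hc := topple_comm hyz hy ha
    refine ⟨⟨⟨h.1.1, h.1.2.trans_le (numActive_le_perform hyz _ ha)⟩, ?_⟩, ?_, h3⟩
    · rw [hc]; exact h1
    · simp only [run]; rw [hc]; exact h2

/-- The first toppling of an active site can be moved to the front of a legal list. -/
theorem Legal.exists_perm_of_mem {α : List V} {s : Config V × Stacks V} (h : Legal Λ b α s)
    {z : V} (hz : z ∈ α) (ha : 1 ≤ (s.1 z).numActive) :
    ∃ β, Legal Λ b β (topple z s) ∧ run β (topple z s) = run α s ∧ α.Perm (z :: β) := by
  obtain ⟨α₁, α₂, rfl, hn⟩ := List.eq_append_cons_of_mem hz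
  obtain ⟨h1, h2⟩ := (legal_append _ _ _).1 h
  obtain ⟨h3, h4, -⟩ := h1.topple_of_notMem hn ha
  refine ⟨α₁ ++ α₂, (legal_append _ _ _).2 ⟨h3, ?_⟩, ?_, List.perm_middle⟩
  · rw [h4]; exact h2.2
  · rw [run_append, run_append, h4]; rfl

/-- The least action principle. -/
theorem Legal.count_le {Λ' : Set V} {b' : V → ℕ} {α β : List V} {s : Config V × Stacks V}
    (hα : Legal Λ b α s)
    (hβ : Legal Λ' b' β s) (hst : ∀ z ∈ α, ((run β s).1 z).numActive = 0) (o : V) :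
    α.count o ≤ β.count o := by
  induction α generalizing s β with
  | nil => simp
  | cons z α ih =>
    have ha : 1 ≤ (s.1 z).numActive := by have := hα.1.2; omega
    -- Topplings elsewhere never deactivate `z`, so if `β` avoided `z` this site would still be
    -- active after `β`.
    have hz : z ∈ β := by
      by_contra hz
      have := (hβ.topple_of_notMem hz ha).2.2
      have := hst z List.mem_cons_self
      omega
    obtain ⟨β', h1, h2, h3⟩ := hβ.exists_perm_of_mem hz ha
    have := ih hα.2 h1 (fun w hw => by rw [h2]; exact hst w (List.mem_cons_of_mem _ hw))
    rw [h3.count_eq, List.count_cons, List.count_cons]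
    omega

/-- A relation between site states which is compatible with the topplings transfers legality. -/
theorem Legal.transfer {Λ' : Set V} {b' : V → ℕ} (R : V → SiteState → SiteState → Prop)
    (harrive : ∀ w a a', R w a a' → R w a.arrive a'.arrive)
    (hready : ∀ w a a', R w a a' → w ∈ Λ → b w < a.numActive →
      w ∈ Λ' ∧ b' w < a'.numActive ∧ R w a.leave a'.leave ∧ R w a.trySleep a'.trySleep)
    {α : List V} {η η' : Config V} {τ : Stacks V} (hR : ∀ w, R w (η w) (η' w))
    (h : Legal Λ b α (η, τ)) : Legal Λ' b' α (η', τ) := by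
  induction α generalizing η η' τ with
  | nil => trivial
  | cons z α ih =>
    obtain ⟨h1, h2, h3, h4⟩ := hready z _ _ (hR z) h.1.1 h.1.2
    refine ⟨⟨h1, h2⟩, ih ?_ h.2⟩
    intro w
    have ha : 1 ≤ (η z).numActive := by have := h.1.2; simp only at this; omega
    have ha' : 1 ≤ (η' z).numActive := by omega
    rw [perform_apply ha, perform_apply ha']
    simp only
    generalize τ (z, 0) = i
    rcases i with _ | y
    · simp only [siteEffect]
      split_ifs with hw
      · subst hw; exact h4
      · exact hR w
    · simp only [siteEffect]
      by_cases hw : w = z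
      · subst hw
        simp only [if_true]
        split_ifs
        · exact harrive _ _ _ h3
        · exact h3
      · simp only [hw, if_false]
        split_ifs
        · exact harrive _ _ _ (hR w)
        · exact hR w

end Abelian

/-! ### Counting topplings -/

/-- The largest number of topplings at `o` in a legal list of length at most `k`. -/
def visits {V : Type*} (Λ : Set V) (b : V → ℕ) (o : V) (k : ℕ) (s : Config V × Stacks V) : ℕ :=
  sSup {c | ∃ α, Legal Λ b α s ∧ α.length ≤ k ∧ α.count o = c}

/-- Some legal list of length at most `k` stabilizes `Λ` and ends in a configuration in `C`. -/
def StabIn {V : Type*} (Λ : Set V) (k : ℕ) (C : Config V → Prop) (s : Config V × Stacks V) :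
    Prop :=
  ∃ α, Legal Λ 0 α s ∧ α.length ≤ k ∧ (∀ z ∈ Λ, ((run α s).1 z).numActive = 0) ∧ C (run α s).1

section Visits

variable {V : Type*} {Λ : Set V} {b : V → ℕ} {o : V} {k : ℕ} {s : Config V × Stacks V}

theorem Legal.count_le_visits {α : List V} (h : Legal Λ b α s) (hk : α.length ≤ k) :
    α.count o ≤ visits Λ b o k s := by
  refine le_csSup ⟨k, ?_⟩ ⟨α, h, hk, rfl⟩
  rintro c ⟨β, -, hβ, rfl⟩
  exact List.count_le_length.trans hβ

theorem exists_legal_count_eq (Λ : Set V) (b : V → ℕ) (o : V) (k : ℕ) (s : Config V × Stacks V) :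
    ∃ α, Legal Λ b α s ∧ α.length ≤ k ∧ α.count o = visits Λ b o k s := by
  refine Nat.sSup_mem (s := {c | ∃ α, Legal Λ b α s ∧ α.length ≤ k ∧ α.count o = c})
    ⟨0, [], trivial, by simp, by simp⟩ ⟨k, ?_⟩
  rintro c ⟨β, -, hβ, rfl⟩
  exact List.count_le_length.trans hβ

theorem visits_le (s : Config V × Stacks V) : visits Λ b o k s ≤ k := by
  obtain ⟨α, -, h, h'⟩ := exists_legal_count_eq Λ b o k s
  rw [← h']
  exact List.count_le_length.trans h

theorem visits_mono_right {k' : ℕ} (h : k ≤ k') (s : Config V × Stacks V) :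
    visits Λ b o k s ≤ visits Λ b o k' s := by
  obtain ⟨α, h1, h2, h3⟩ := exists_legal_count_eq Λ b o k s
  rw [← h3]
  exact h1.count_le_visits (h2.trans h)

theorem visits_le_of_legal_imp {Λ' : Set V} {b' : V → ℕ} {s' : Config V × Stacks V}
    (h : ∀ α, Legal Λ b α s → Legal Λ' b' α s') : visits Λ b o k s ≤ visits Λ' b' o k s' := by
  obtain ⟨α, h1, h2, h3⟩ := exists_legal_count_eq Λ b o k s
  rw [← h3]
  exact (h α h1).count_le_visits h2

/-- In an optimal list, the first toppling at `z` is moved to the front and dropped; a list avoiding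
`z` stays legal after the toppling. Hence `z` only has to be active: it may lie outside `Λ` or be
held back by `b`. -/
theorem visits_le_topple {z : V} (ha : 1 ≤ (s.1 z).numActive) :
    visits Λ b o k s ≤ (if z = o then 1 else 0) + visits Λ b o k (topple z s) := by
  obtain ⟨α, h1, h2, h3⟩ := exists_legal_count_eq Λ b o k s
  rw [← h3]
  by_cases hz : z ∈ α
  · obtain ⟨β, h4, -, h5⟩ := h1.exists_perm_of_mem hz ha
    have hl := h5.length_eq
    have := h4.count_le_visits (o := o) (k := k) (by simp at hl; omega)
    rw [h5.count_eq, List.count_cons]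
    simp only [beq_iff_eq]
    omega
  · exact ((h1.topple_of_notMem hz ha).1.count_le_visits h2).trans (Nat.le_add_left _ _)

theorem topple_visits_le {z : V} (hz : z ∈ Λ) (ha : b z < (s.1 z).numActive) :
    (if z = o then 1 else 0) + visits Λ b o k (topple z s) ≤ visits Λ b o (k + 1) s := by
  obtain ⟨α, h1, h2, h3⟩ := exists_legal_count_eq Λ b o k (topple z s)
  have h : Legal Λ b (z :: α) s := ⟨⟨hz, ha⟩, h1⟩
  have := h.count_le_visits (o := o) (k := k + 1) (by simpa using h2)
  rw [List.count_cons, h3] at this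
  simp only [beq_iff_eq] at this
  omega

/-- A stabilizing list must topple every active site of `Λ`, and by commutation it may begin with
any of them. This freedom of choice drives the one-step recursions below. -/
theorem stabIn_succ_iff {z : V} {C : Config V → Prop} (hz : z ∈ Λ) (ha : 0 < (s.1 z).numActive) :
    StabIn Λ (k + 1) C s ↔ StabIn Λ k C (topple z s) := by
  constructor
  · rintro ⟨α, h1, h2, h3, h4⟩
    have hzα : z ∈ α := by
      by_contra h
      have := (h1.topple_of_notMem h ha).2.2
      have := h3 z hz
      omega
    obtain ⟨β, h5, h6, h7⟩ := h1.exists_perm_of_mem hzα ha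
    have hl := h7.length_eq
    exact ⟨β, h5, by simp at hl; omega, by rwa [h6], by rwa [h6]⟩
  · rintro ⟨α, h1, h2, h3, h4⟩
    exact ⟨z :: α, ⟨⟨hz, ha⟩, h1⟩, by simpa using h2, h3, h4⟩

theorem stabIn_iff_of_stable {C : Config V → Prop} (h : ∀ z ∈ Λ, (s.1 z).numActive = 0) :
    StabIn Λ k C s ↔ C s.1 := by
  constructor
  · rintro ⟨α, h1, -, -, h4⟩
    rcases α with _ | ⟨z, α⟩
    · exact h4
    · have := h1.1.2
      rw [h z h1.1.1] at this
      simp at this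
  · exact fun hC => ⟨[], trivial, by simp, h, hC⟩

theorem not_stabIn_zero {C : Config V → Prop} {z : V} (hz : z ∈ Λ) (ha : 0 < (s.1 z).numActive) :
    ¬ StabIn Λ 0 C s := by
  rintro ⟨α, h1, h2, h3, -⟩
  obtain rfl : α = [] := by simpa using h2
  have := h3 z hz
  simp only [run] at this
  omega

theorem exists_legal_of_not_stabIn (h : ¬ StabIn Λ k (fun _ => True) s) :
    ∃ α, Legal Λ 0 α s ∧ α.length = k + 1 := by
  by_cases hs : ∀ z ∈ Λ, (s.1 z).numActive = 0
  · exact absurd ((stabIn_iff_of_stable hs).2 trivial) h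
  push Not at hs
  obtain ⟨z, hz, ha⟩ := hs
  have ha : 0 < (s.1 z).numActive := Nat.pos_of_ne_zero ha
  induction k generalizing s z with
  | zero => exact ⟨[z], ⟨⟨hz, ha⟩, trivial⟩, rfl⟩
  | succ k ih =>
    rw [stabIn_succ_iff hz ha] at h
    have : ∃ w ∈ Λ, ((topple z s).1 w).numActive ≠ 0 := by
      by_contra hc
      push Not at hc
      exact h ((stabIn_iff_of_stable hc).2 trivial)
    obtain ⟨w, hw, hw'⟩ := this
    obtain ⟨α, h1, h2⟩ := ih h w hw hw' (Nat.pos_of_ne_zero hw')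
    exact ⟨z :: α, ⟨⟨hz, ha⟩, h1⟩, by simp [h2]⟩

/-- Legality is monotone in the configuration, which only matters in `Λ`. -/
theorem Legal.mono_config {Λ' : Set V} {b' : V → ℕ} {α : List V} {η η' : Config V} {τ : Stacks V}
    (hΛ : Λ ⊆ Λ') (hb : b' ≤ b) (hη : ∀ w ∈ Λ, (η w).rank ≤ (η' w).rank)
    (h : Legal Λ b α (η, τ)) : Legal Λ' b' α (η', τ) := by
  refine h.transfer (fun w a a' => w ∈ Λ → a.rank ≤ a'.rank)
    (fun w a a' hw hwΛ => SiteState.rank_arrive_mono (hw hwΛ)) ?_ hη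
  intro w a a' hw hwΛ ha
  obtain ⟨h1, h2, h3⟩ := SiteState.rank_active_mono (hw hwΛ) (by omega)
  exact ⟨hΛ hwΛ, ((hb w).trans_lt ha).trans_le h1, fun _ => h2, fun _ => h3⟩

/-! ### Adding a particle -/

/-- Add an active particle at `z`. -/
def place (η : Config V) (z : V) : Config V := Function.update η z (η z).arrive

theorem place_apply (η : Config V) (z w : V) :
    place η z w = if w = z then (η w).arrive else η w := by
  unfold place
  rw [Function.update_apply]
  split_ifs with h
  · rw [h]
  · rfl

theorem one_le_numActive_place (η : Config V) (z : V) : 1 ≤ (place η z z).numActive := by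
  rw [place_apply, if_pos rfl]
  rcases η z with _ | n <;> simp [SiteState.arrive, SiteState.numActive]

/-- The added particle simply moves from `z` to `y`. A sleeper at `z` would have been woken by the
arrival and would stay awake. -/
theorem perform_jump_place {η : Config V} {z : V} (h : η z ≠ .sleeping) (y : V) :
    perform z (.jump y) (place η z) = place η y := by
  funext w
  rw [perform_apply (one_le_numActive_place η z), place_apply, place_apply]
  simp only [siteEffect]
  by_cases hw : w = z
  · subst hw
    rcases hη : η w with _ | n
    · exact absurd hη h
    · simp [SiteState.arrive, SiteState.leave]
  · simp [hw]

/-- For upper bounds a sleep instruction can therefore be treated as a lazy step of the added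
particle. -/
theorem rank_perform_sleep_le (η : Config V) (z w : V) :
    (perform z .sleep η w).rank ≤ (η w).rank := by
  simp only [perform, Function.update_apply]
  split_ifs with h
  · subst h
    rcases η w with _ | _ | _ | n <;> simp [SiteState.trySleep, SiteState.rank]
  · rfl

/-- A particle that is added at `x` and held there covers the role of the last active
particle. -/
theorem Legal.hold {x : V} {α : List V} {η : Config V} {τ : Stacks V} (hx : η x ≠ .sleeping)
    (h : Legal Λ 0 α (η, τ)) : Legal Λ (Pi.single x 1) α (place η x, τ) := by
  refine h.transfer
    -- With one particle more at `x`, counted against sleepers too, the enlarged configuration never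
    -- falls asleep there: when `active 1` becomes `sleeping`, its partner `active 2` is unchanged.
    (fun w a a' => if w = x then a' = .active (a.card + 1) else a' = a) ?_ ?_ ?_
  · intro w a a' h
    split_ifs at h ⊢
    · subst h; rcases a with _ | n <;> simp [SiteState.arrive, SiteState.card]
    · rw [h]
  · intro w a a' h hw ha
    split_ifs at h ⊢ with hwx
    · subst h hwx
      rcases a with _ | _ | _ | n <;>
        simp_all [SiteState.leave, SiteState.trySleep, SiteState.card, SiteState.numActive]
    · subst h
      simpa [hwx, hw] using ha
  · intro w
    rw [place_apply]
    split_ifs with hwx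
    · subst hwx
      rcases hη : η w with _ | n
      · exact absurd hη hx
      · simp [SiteState.arrive, SiteState.card]
    · rfl

end Visits

end

end ARW

/-! ### One-step analysis for random stacks -/

namespace ARW

noncomputable section

open scoped Classical

/-! ### The law of the stacks -/

section StackLaw

variable {V : Type*} (G : SimpleGraph V) [G.LocallyFinite] (lam : ℝ)

/-- The mean of a function of the first instruction at `z`. -/
def stepMean (z : V) (h : Instruction V → ℝ) : ℝ :=
  lam / (1 + lam) * h .sleep +
    ∑ y ∈ G.neighborFinset z, 1 / (G.degree z * (1 + lam)) * h (.jump y)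

/-- The law of independent stacks of instructions. -/
def stackLaw : Measure (Stacks V) :=
  Measure.infinitePi fun p : V × ℕ => instructionLaw G lam p.1

variable {G lam}

theorem stepMean_mono (hlam : 0 ≤ lam) {z : V} {h h' : Instruction V → ℝ}
    (hs : h .sleep ≤ h' .sleep) (hj : ∀ y, G.Adj z y → h (.jump y) ≤ h' (.jump y)) :
    stepMean G lam z h ≤ stepMean G lam z h' := by
  unfold stepMean
  have : 0 ≤ lam / (1 + lam) := by positivity
  have : ∀ y, G.Adj z y → 0 ≤ 1 / (G.degree z * (1 + lam)) := fun y _ => by positivity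
  gcongr with y hy
  exact hj y (by simpa using hy)

theorem stepMean_add (z : V) (h h' : Instruction V → ℝ) :
    stepMean G lam z (fun i => h i + h' i) = stepMean G lam z h + stepMean G lam z h' := by
  simp only [stepMean, mul_add, Finset.sum_add_distrib]
  ring

theorem stepMean_const_mul (z : V) (c : ℝ) (h : Instruction V → ℝ) :
    stepMean G lam z (fun i => c * h i) = c * stepMean G lam z h := by
  simp only [stepMean, mul_add, Finset.mul_sum]
  congr 1
  · ring
  · exact Finset.sum_congr rfl fun y _ => by ring

theorem stepMean_sum {ι : Type*} (s : Finset ι) (z : V) (h : ι → Instruction V → ℝ) :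
    stepMean G lam z (fun i => ∑ j ∈ s, h j i) = ∑ j ∈ s, stepMean G lam z (h j) := by
  simp only [stepMean, Finset.mul_sum, Finset.sum_add_distrib]
  congr 1
  rw [Finset.sum_comm]

theorem stepMean_const (hlam : 0 ≤ lam) {z : V} (hz : 0 < G.degree z) (c : ℝ) :
    stepMean G lam z (fun _ => c) = c := by
  simp only [stepMean, Finset.sum_const, SimpleGraph.card_neighborFinset_eq_degree, nsmul_eq_mul]
  have : (0 : ℝ) < G.degree z := by exact_mod_cast hz
  field_simp
  ring

theorem stepMean_eq (z : V) (h : Instruction V → ℝ) :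
    stepMean G lam z h = lam / (1 + lam) * h .sleep +
      1 / (1 + lam) * ((∑ y ∈ G.neighborFinset z, h (.jump y)) / G.degree z) := by
  simp only [stepMean, Finset.sum_div, Finset.mul_sum]
  congr 1
  refine Finset.sum_congr rfl fun y _ => ?_
  rw [one_div_mul_eq_div, one_div_mul_eq_div, div_div]

theorem isProbabilityMeasure_instructionLaw (hlam : 0 ≤ lam) {z : V} (hz : 0 < G.degree z) :
    IsProbabilityMeasure (instructionLaw G lam z) := by
  constructor
  have h1 : (0 : ℝ) < G.degree z := by exact_mod_cast hz
  simp only [instructionLaw, Measure.coe_add, Pi.add_apply, Measure.coe_smul, Pi.smul_apply,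
    Measure.finsetSum_apply, measure_univ, smul_eq_mul, mul_one, Finset.sum_const,
    SimpleGraph.card_neighborFinset_eq_degree, nsmul_eq_mul]
  rw [← ENNReal.ofReal_natCast, ← ENNReal.ofReal_mul (by positivity), ← ENNReal.ofReal_add
    (by positivity) (by positivity), ← ENNReal.ofReal_one]
  congr 1
  field_simp
  ring

theorem isProbabilityMeasure_stackLaw (hlam : 0 ≤ lam) (hdeg : ∀ z, 0 < G.degree z) :
    IsProbabilityMeasure (stackLaw G lam) := by
  have := fun p : V × ℕ => isProbabilityMeasure_instructionLaw (G := G) hlam (hdeg p.1)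
  unfold stackLaw
  infer_instance

theorem integral_instructionLaw (hlam : 0 ≤ lam) (z : V) (h : Instruction V → ℝ) :
    ∫ i, h i ∂instructionLaw G lam z = stepMean G lam z h := by
  have hd : ∀ (c : ENNReal) (i : Instruction V), c ≠ ⊤ →
      Integrable h (c • Measure.dirac i) := fun c i hc =>
    (integrable_dirac (by simp)).smul_measure hc
  unfold instructionLaw stepMean
  rw [integral_add_measure (hd _ _ ENNReal.ofReal_ne_top)
    ((integrable_finsetSum_measure).2 fun y _ => hd _ _ ENNReal.ofReal_ne_top),
    integral_finsetSum_measure (fun y _ => hd _ _ ENNReal.ofReal_ne_top)]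
  simp only [integral_smul_measure, integral_dirac, smul_eq_mul]
  rw [ENNReal.toReal_ofReal (by positivity)]
  congr 1
  refine Finset.sum_congr rfl fun y _ => ?_
  rw [ENNReal.toReal_ofReal (by positivity)]

theorem measurable_tailAt (z : V) : Measurable (tailAt z : Stacks V → Stacks V) := by
  refine measurable_pi_lambda _ fun p => ?_
  simp only [tailAt]
  split_ifs
  · exact measurable_pi_apply _
  · exact measurable_pi_apply _

theorem measurable_consAt (z : V) :
    Measurable fun q : Instruction V × Stacks V => consAt z q.1 q.2 := by
  refine measurable_pi_lambda _ fun p => ?_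
  rcases p with ⟨w, n⟩
  simp only [consAt]
  split_ifs
  · rcases n with _ | n
    · exact measurable_fst
    · exact (measurable_pi_apply _).comp measurable_snd
  · exact (measurable_pi_apply _).comp measurable_snd

/-- Adding an independent instruction to a stack does not change the law of the stacks. -/
theorem map_consAt_stackLaw (hlam : 0 ≤ lam) (hdeg : ∀ z, 0 < G.degree z) (z : V) :
    ((instructionLaw G lam z).prod (stackLaw G lam)).map (fun q => consAt z q.1 q.2) =
      stackLaw G lam := by
  have hI := fun p : V × ℕ => isProbabilityMeasure_instructionLaw (G := G) hlam (hdeg p.1)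
  have hS := isProbabilityMeasure_stackLaw hlam hdeg
  have hIz := hI (z, 0)
  refine Measure.eq_infinitePi _ fun s t ht => ?_
  rw [Measure.map_apply (measurable_consAt z) (MeasurableSet.pi s.countable_toSet fun i _ => ht i)]
  -- `f` is the index shift caused by `consAt`, a bijection onto the complement of `(z, 0)`.
  -- Reindexing by it turns the product of the laws over `s` into the factor at `(z, 0)`, if
  -- present, times a product over `s'`.
  let f : V × ℕ → V × ℕ := fun p => if p.1 = z then (p.1, p.2 + 1) else p
  have hf : Function.Injective f := by
    rintro ⟨a, m⟩ ⟨c, n⟩ h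
    simp only [f] at h
    split_ifs at h with h1 h2 h2 <;> simp_all
  have hf0 : ∀ q, f q ≠ (z, 0) := by
    rintro ⟨a, m⟩ h
    simp only [f] at h
    split_ifs at h with h1 <;> simp_all
  have hfs : ∀ p, p ≠ (z, 0) → ∃ q, f q = p := by
    rintro ⟨a, m⟩ h
    by_cases h1 : a = z
    · subst h1
      rcases m with _ | m
      · exact absurd rfl h
      · exact ⟨(a, m), by simp [f]⟩
    · exact ⟨(a, m), by simp [f, h1]⟩
  have hfc : ∀ i τ q, consAt z i τ (f q) = τ q := by
    rintro i τ ⟨a, m⟩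
    by_cases h1 : a = z <;> simp [f, consAt, h1]
  have hfl : ∀ q, (f q).1 = q.1 := by
    rintro ⟨a, m⟩
    by_cases h1 : a = z <;> simp [f, h1]
  set s' : Finset (V × ℕ) := s.preimage f hf.injOn with hs'
  have hpre : (fun q : Instruction V × Stacks V => consAt z q.1 q.2) ⁻¹' (Set.pi s t) =
      (if (z, 0) ∈ s then t (z, 0) else Set.univ) ×ˢ (Set.pi s' fun q => t (f q)) := by
    ext ⟨i, τ⟩
    simp only [Set.mem_preimage, Set.mem_pi, Set.mem_prod, Finset.mem_coe, hs',
      Finset.mem_preimage]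
    constructor
    · intro h
      refine ⟨?_, fun q hq => ?_⟩
      · split_ifs with h0
        · simpa [consAt_self] using h _ h0
        · trivial
      · simpa [hfc] using h _ hq
    · rintro ⟨h1, h2⟩ p hp
      by_cases h0 : p = (z, 0)
      · subst h0
        rw [if_pos hp] at h1
        simpa [consAt_self] using h1
      · obtain ⟨q, rfl⟩ := hfs p h0
        rw [hfc]
        exact h2 q hp
  rw [hpre, Measure.prod_prod]
  have h2 : stackLaw G lam (Set.pi s' fun q => t (f q)) =
      ∏ q ∈ s', instructionLaw G lam q.1 (t (f q)) :=
    Measure.infinitePi_pi _ fun q _ => ht _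
  have h3 : ∏ q ∈ s', instructionLaw G lam q.1 (t (f q)) =
      ∏ p ∈ s.erase (z, 0), instructionLaw G lam p.1 (t p) := by
    refine Finset.prod_bij (fun q _ => f q) ?_ ?_ ?_ ?_
    · intro q hq
      exact Finset.mem_erase.2 ⟨hf0 q, by simpa [hs'] using hq⟩
    · intro q _ q' _ h
      exact hf h
    · intro p hp
      obtain ⟨q, rfl⟩ := hfs p (Finset.mem_erase.1 hp).1
      exact ⟨q, by simpa [hs'] using (Finset.mem_erase.1 hp).2, rfl⟩
    · intro q _
      rw [hfl]
  rw [h2, h3]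
  split_ifs with h0
  · rw [Finset.mul_prod_erase s (fun p => instructionLaw G lam p.1 (t p)) h0]
  · rw [measure_univ, one_mul, Finset.erase_eq_of_notMem h0]

end StackLaw

/-! ### Expectations over the stacks -/

section Expectation

variable {V : Type*} (G : SimpleGraph V) [G.LocallyFinite] (lam : ℝ)

/-- A bounded function of a configuration and stacks, measurable in the stacks. -/
structure BddMeas (F : Config V × Stacks V → ℝ) : Prop where
  meas : ∀ η, Measurable fun τ => F (η, τ)
  bdd : ∃ C, ∀ s, |F s| ≤ C

/-- The expectation over the stacks. -/
def stackMean (F : Config V × Stacks V → ℝ) (η : Config V) : ℝ :=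
  ∫ τ, F (η, τ) ∂stackLaw G lam

variable {G lam}

theorem BddMeas.integrable (hlam : 0 ≤ lam) (hdeg : ∀ z, 0 < G.degree z)
    {F : Config V × Stacks V → ℝ} (hF : BddMeas F) (η : Config V) :
    Integrable (fun τ => F (η, τ)) (stackLaw G lam) := by
  have hS := isProbabilityMeasure_stackLaw hlam hdeg
  obtain ⟨C, hC⟩ := hF.bdd
  exact Integrable.of_bound (hF.meas η).aestronglyMeasurable C (ae_of_all _ fun τ => hC _)

theorem stackMean_mono (hlam : 0 ≤ lam) (hdeg : ∀ z, 0 < G.degree z)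
    {F F' : Config V × Stacks V → ℝ} (hF : BddMeas F) (hF' : BddMeas F') {η η' : Config V}
    (h : ∀ τ, F (η, τ) ≤ F' (η', τ)) : stackMean G lam F η ≤ stackMean G lam F' η' :=
  integral_mono (hF.integrable hlam hdeg η) (hF'.integrable hlam hdeg η') h

theorem stackMean_const (hlam : 0 ≤ lam) (hdeg : ∀ z, 0 < G.degree z) (c : ℝ) (η : Config V) :
    stackMean G lam (fun _ => c) η = c := by
  have hS := isProbabilityMeasure_stackLaw hlam hdeg
  simp [stackMean]

theorem stackMean_add (hlam : 0 ≤ lam) (hdeg : ∀ z, 0 < G.degree z)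
    {F F' : Config V × Stacks V → ℝ} (hF : BddMeas F) (hF' : BddMeas F') (η : Config V) :
    stackMean G lam (fun s => F s + F' s) η = stackMean G lam F η + stackMean G lam F' η :=
  integral_add (hF.integrable hlam hdeg η) (hF'.integrable hlam hdeg η)

theorem stackMean_const_mul (c : ℝ) (F : Config V × Stacks V → ℝ) (η : Config V) :
    stackMean G lam (fun s => c * F s) η = c * stackMean G lam F η :=
  integral_const_mul c _

theorem bddMeas_const (c : ℝ) : BddMeas fun _ : Config V × Stacks V => c :=
  ⟨fun _ => measurable_const, |c|, fun _ => le_rfl⟩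

theorem BddMeas.add {F F' : Config V × Stacks V → ℝ} (hF : BddMeas F) (hF' : BddMeas F') :
    BddMeas fun s => F s + F' s := by
  obtain ⟨C, hC⟩ := hF.bdd
  obtain ⟨C', hC'⟩ := hF'.bdd
  exact ⟨fun η => (hF.meas η).add (hF'.meas η), C + C', fun s =>
    (abs_add_le _ _).trans (add_le_add (hC s) (hC' s))⟩

theorem BddMeas.const_mul {F : Config V × Stacks V → ℝ} (hF : BddMeas F) (c : ℝ) :
    BddMeas fun s => c * F s := by
  obtain ⟨C, hC⟩ := hF.bdd
  refine ⟨fun η => (hF.meas η).const_mul c, |c| * C, fun s => ?_⟩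
  rw [abs_mul]
  exact mul_le_mul_of_nonneg_left (hC s) (abs_nonneg _)

instance [Countable V] : Countable (Instruction V) := by
  refine Function.Injective.countable (β := Option V)
    (f := fun i => match i with | .sleep => none | .jump y => some y) ?_
  rintro (_ | a) (_ | c) h <;> simp_all

/-- After the toppling the configuration depends on the stacks only through one instruction, which
takes countably many values. So no σ-algebra on configurations is needed. -/
theorem measurable_comp_topple [Countable V] {β : Type*} [MeasurableSpace β]
    {F : Config V × Stacks V → β} (hF : ∀ η, Measurable fun τ => F (η, τ)) (z : V) (η : Config V) :
    Measurable fun τ => F (topple z (η, τ)) := by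
  have : Measurable fun q : Instruction V × Stacks V => F (perform z q.1 η, q.2) :=
    measurable_from_prod_countable_right fun i => hF (perform z i η)
  exact this.comp ((measurable_pi_apply (z, 0)).prodMk (measurable_tailAt z))

theorem BddMeas.comp_topple [Countable V] {F : Config V × Stacks V → ℝ} (hF : BddMeas F) (z : V) :
    BddMeas fun s => F (topple z s) :=
  ⟨measurable_comp_topple hF.meas z, hF.bdd.imp fun _ hC _ => hC _⟩

/-- The expectation after one toppling. -/
theorem stackMean_topple [Countable V] (hlam : 0 ≤ lam) (hdeg : ∀ z, 0 < G.degree z)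
    {F : Config V × Stacks V → ℝ} (hF : BddMeas F) (z : V) (η : Config V) :
    stackMean G lam (fun s => F (topple z s)) η =
      stepMean G lam z (fun i => stackMean G lam F (perform z i η)) := by
  have hS := isProbabilityMeasure_stackLaw hlam hdeg
  have hI := isProbabilityMeasure_instructionLaw (G := G) hlam (hdeg z)
  have hm := (hF.comp_topple z).meas η
  obtain ⟨C, hC⟩ := hF.bdd
  rw [stackMean, ← map_consAt_stackLaw hlam hdeg z, integral_map
    (measurable_consAt z).aemeasurable hm.aestronglyMeasurable]
  simp only [topple_consAt]
  rw [integral_prod, integral_instructionLaw hlam]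
  · rfl
  · refine Integrable.of_bound (Measurable.aestronglyMeasurable ?_) C (ae_of_all _ fun q => hC _)
    exact measurable_from_prod_countable_right fun i => hF.meas (perform z i η)

theorem measurable_legal [Countable V] (Λ : Set V) (b : V → ℕ) (α : List V) (η : Config V) :
    Measurable fun τ => Legal Λ b α (η, τ) := by
  induction α generalizing η with
  | nil => exact measurable_const
  | cons z α ih =>
    simp only [Legal]
    exact measurable_const.and (measurable_comp_topple ih z η)

theorem measurable_run [Countable V] (C : Config V → Prop) (α : List V) (η : Config V) :
    Measurable fun τ => C (run α (η, τ)).1 := by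
  induction α generalizing η with
  | nil => exact measurable_const (a := C η)
  | cons z α ih => exact measurable_comp_topple (F := fun s => C (run α s).1) ih z η

theorem measurable_visits [Countable V] (Λ : Set V) (b : V → ℕ) (o : V) (k : ℕ) (η : Config V) :
    Measurable fun τ => visits Λ b o k (η, τ) := by
  refine measurable_of_Ici fun c => ?_
  have : (fun τ => visits Λ b o k (η, τ)) ⁻¹' Set.Ici c =
      {τ | ∃ α : List V, Legal Λ b α (η, τ) ∧ α.length ≤ k ∧ c ≤ α.count o} := by
    ext τ
    simp only [Set.mem_preimage, Set.mem_Ici, Set.mem_ofPred_eq]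
    constructor
    · intro h
      obtain ⟨α, h1, h2, h3⟩ := exists_legal_count_eq Λ b o k (η, τ)
      exact ⟨α, h1, h2, h3 ▸ h⟩
    · rintro ⟨α, h1, h2, h3⟩
      exact h3.trans (h1.count_le_visits h2)
  rw [this]
  exact measurableSet_setOfPred.2 (Measurable.exists fun α =>
    (measurable_legal Λ b α η).and measurable_const)

theorem measurable_stabIn [Countable V] (Λ : Set V) (k : ℕ) (C : Config V → Prop) (η : Config V) :
    Measurable fun τ => StabIn Λ k C (η, τ) := by
  unfold StabIn
  exact Measurable.exists fun α => (measurable_legal Λ 0 α η).and (measurable_const.and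
    (measurable_run (fun ζ => (∀ z ∈ Λ, (ζ z).numActive = 0) ∧ C ζ) α η))

theorem bddMeas_visits_pow [Countable V] (Λ : Set V) (b : V → ℕ) (o : V) (k n : ℕ) :
    BddMeas fun s => (visits Λ b o k s : ℝ) ^ n := by
  refine ⟨fun η => ?_, (k : ℝ) ^ n, fun s => ?_⟩
  · exact ((measurable_from_nat (f := fun m : ℕ => (m : ℝ))).comp
      (measurable_visits Λ b o k η)).pow_const n
  · rw [abs_of_nonneg (by positivity)]
    gcongr
    exact visits_le s

theorem bddMeas_visits [Countable V] (Λ : Set V) (b : V → ℕ) (o : V) (k : ℕ) :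
    BddMeas fun s => (visits Λ b o k s : ℝ) := by
  simpa using bddMeas_visits_pow Λ b o k 1

theorem bddMeas_stabIn [Countable V] (Λ : Set V) (k : ℕ) (C : Config V → Prop) :
    BddMeas fun s => if StabIn Λ k C s then (1 : ℝ) else 0 := by
  refine ⟨fun η => ?_, 1, fun s => ?_⟩
  · exact Measurable.ite (measurableSet_setOfPred.2 (measurable_stabIn Λ k C η)) measurable_const
      measurable_const
  · split_ifs <;> simp

end Expectation

end

end ARW

/-! ### Potential theory of walk killed outside a finite set -/

namespace ARW

noncomputable section

open scoped Classical

/-! ### Killed random walk -/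

section Green

variable {V : Type*} (G : SimpleGraph V) [G.LocallyFinite]

/-- The average over the neighbours. -/
def nbrAvg (f : V → ℝ) (z : V) : ℝ := (∑ y ∈ G.neighborFinset z, f y) / G.degree z

variable {G}

theorem nbrAvg_mono {f f' : V → ℝ} {z : V} (h : ∀ y, G.Adj z y → f y ≤ f' y) :
    nbrAvg G f z ≤ nbrAvg G f' z := by
  unfold nbrAvg
  gcongr with y hy
  exact h y (by simpa using hy)

theorem nbrAvg_add (f f' : V → ℝ) (z : V) :
    nbrAvg G (fun y => f y + f' y) z = nbrAvg G f z + nbrAvg G f' z := by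
  simp only [nbrAvg, Finset.sum_add_distrib, add_div]

theorem nbrAvg_const_mul (c : ℝ) (f : V → ℝ) (z : V) :
    nbrAvg G (fun y => c * f y) z = c * nbrAvg G f z := by
  simp only [nbrAvg, ← Finset.mul_sum, mul_div_assoc]

theorem nbrAvg_const (hdeg : ∀ z, 0 < G.degree z) (c : ℝ) (z : V) :
    nbrAvg G (fun _ => c) z = c := by
  have : (0 : ℝ) < G.degree z := by exact_mod_cast hdeg z
  simp only [nbrAvg, Finset.sum_const, SimpleGraph.card_neighborFinset_eq_degree, nsmul_eq_mul]
  field_simp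

/-- The maximum principle for subharmonic functions. -/
theorem le_zero_of_le_nbrAvg [Infinite V] (hconn : G.Connected) (hdeg : ∀ z, 0 < G.degree z)
    (Λ : Finset V) {a : V → ℝ} (ha : ∀ z ∈ Λ, a z ≤ nbrAvg G a z) (ha0 : ∀ z, z ∉ Λ → a z ≤ 0)
    (z : V) : a z ≤ 0 := by
  by_contra! hz
  have hzΛ : z ∈ Λ := by
    by_contra h
    exact absurd (ha0 z h) (not_le.2 hz)
  obtain ⟨m, hm, hmax⟩ := Λ.exists_max_image a ⟨z, hzΛ⟩
  have hpos : 0 < a m := hz.trans_le (hmax z hzΛ)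
  have hle : ∀ y, a y ≤ a m := fun y => by
    by_cases hy : y ∈ Λ
    · exact hmax y hy
    · exact (ha0 y hy).trans hpos.le
  have hmem : ∀ y, a y = a m → y ∈ Λ := fun y hy => by
    by_contra h
    exact absurd (ha0 y h) (not_le.2 (hy ▸ hpos))
  have hstep : ∀ y w, G.Adj y w → a y = a m → a w = a m := by
    intro y w hyw hy
    refine le_antisymm (hle w) ?_
    by_contra! hw
    have h1 := ha y (hmem y hy)
    have hd : (0 : ℝ) < G.degree y := by exact_mod_cast hdeg y
    have h2 : ∑ u ∈ G.neighborFinset y, a u < ∑ u ∈ G.neighborFinset y, a m :=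
      Finset.sum_lt_sum (fun u _ => hle u) ⟨w, by simpa using hyw, hw⟩
    rw [Finset.sum_const, SimpleGraph.card_neighborFinset_eq_degree, nsmul_eq_mul] at h2
    rw [nbrAvg, le_div_iff₀ hd, hy] at h1
    linarith
  -- A positive maximum would spread along walks to all of `V`, although it can be attained only in
  -- the finite set `Λ`.
  have hall : ∀ y, a y = a m := by
    intro y
    obtain ⟨p⟩ := hconn.preconnected m y
    have : ∀ (u v : V) (_ : G.Walk u v), a u = a m → a v = a m := by
      intro u v p
      induction p with
      | nil => exact id
      | cons h _ ih => exact fun hu => ih (hstep _ _ h hu)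
    exact this m y p rfl
  obtain ⟨y, hy⟩ := Infinite.exists_notMem_finset Λ
  exact hy (hmem y (hall y))

variable (G)

/-- The probability that random walk started at `z` is at `o` at time `n` and has not left `Λ`. -/
def killedProb (Λ : Finset V) (o : V) : ℕ → V → ℝ
  | 0, z => if z = o then 1 else 0
  | n + 1, z => if z ∈ Λ then nbrAvg G (killedProb Λ o n) z else 0

/-- The expected number of visits to `o` before leaving `Λ`. -/
def green (Λ : Finset V) (o z : V) : ℝ := ∑' n, killedProb G Λ o n z

variable {G}

theorem walkProb_nonneg (n : ℕ) (x y : V) : 0 ≤ walkProb G n x y := by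
  induction n generalizing x with
  | zero => simp only [walkProb]; split_ifs <;> simp
  | succ n ih => exact div_nonneg (Finset.sum_nonneg fun z _ => ih z) (by positivity)

theorem killedProb_nonneg (Λ : Finset V) (o : V) (n : ℕ) (z : V) :
    0 ≤ killedProb G Λ o n z := by
  induction n generalizing z with
  | zero => simp only [killedProb]; split_ifs <;> simp
  | succ n ih =>
    simp only [killedProb]
    split_ifs
    · exact div_nonneg (Finset.sum_nonneg fun z _ => ih z) (by positivity)
    · exact le_rfl

theorem killedProb_le_walkProb (Λ : Finset V) (o : V) (n : ℕ) (z : V) :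
    killedProb G Λ o n z ≤ walkProb G n z o := by
  induction n generalizing z with
  | zero => exact le_rfl
  | succ n ih =>
    simp only [killedProb]
    split_ifs
    · exact nbrAvg_mono fun y _ => ih y
    · exact walkProb_nonneg _ _ _

/-- At time 0 the definition does not look at `Λ`, hence the assumption on `o`. -/
theorem killedProb_of_notMem {Λ : Finset V} {o : V} (ho : o ∈ Λ) (n : ℕ) {z : V} (hz : z ∉ Λ) :
    killedProb G Λ o n z = 0 := by
  rcases n with _ | n
  · simp only [killedProb]
    rw [if_neg]
    rintro rfl
    exact hz ho
  · simp only [killedProb, if_neg hz]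

theorem sum_killedProb_succ (Λ : Finset V) (o : V) (N : ℕ) {z : V} (hz : z ∈ Λ) :
    ∑ n ∈ Finset.range (N + 1), killedProb G Λ o n z =
      (if z = o then 1 else 0) +
        nbrAvg G (fun y => ∑ n ∈ Finset.range N, killedProb G Λ o n y) z := by
  rw [Finset.sum_range_succ', add_comm]
  congr 1
  simp only [killedProb, if_pos hz, nbrAvg]
  rw [← Finset.sum_div, Finset.sum_comm]

/-- The partial sums grow with `N` and satisfy the recursion `sum_killedProb_succ`, so they are
subharmonic on `Λ.erase o`. By the maximum principle they are largest at `o`, where transience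
bounds them. -/
theorem sum_killedProb_le [Infinite V] (hconn : G.Connected) (hdeg : ∀ z, 0 < G.degree z)
    (htr : Transient G) {Λ : Finset V} {o : V} (ho : o ∈ Λ) (N : ℕ) (z : V) :
    ∑ n ∈ Finset.range N, killedProb G Λ o n z ≤ ∑' n, walkProb G n o o := by
  set S : V → ℝ := fun z => ∑ n ∈ Finset.range N, killedProb G Λ o n z with hS
  have hSo : S o ≤ ∑' n, walkProb G n o o :=
    (Finset.sum_le_sum fun n _ => killedProb_le_walkProb Λ o n o).trans
      ((htr o).sum_le_tsum _ fun n _ => walkProb_nonneg n o o)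
  have hS0 : ∀ y, 0 ≤ S y := fun y => Finset.sum_nonneg fun n _ => killedProb_nonneg Λ o n y
  have : S z - S o ≤ 0 := by
    refine le_zero_of_le_nbrAvg hconn hdeg (Λ.erase o) (a := fun z => S z - S o) ?_ ?_ z
    · intro y hy
      obtain ⟨hyo, hyΛ⟩ := Finset.mem_erase.1 hy
      have h1 := sum_killedProb_succ (G := G) Λ o N hyΛ
      rw [if_neg hyo, zero_add] at h1
      have h2 : S y ≤ ∑ n ∈ Finset.range (N + 1), killedProb G Λ o n y := by
        rw [Finset.sum_range_succ]
        exact le_add_of_nonneg_right (killedProb_nonneg Λ o N y)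
      simp only [sub_eq_add_neg]
      rw [nbrAvg_add, nbrAvg_const hdeg]
      linarith
    · intro y hy
      by_cases hyo : y = o
      · simp [hyo]
      · have hyΛ : y ∉ Λ := fun h => hy (Finset.mem_erase.2 ⟨hyo, h⟩)
        have : S y = 0 := Finset.sum_eq_zero fun n _ => killedProb_of_notMem ho n hyΛ
        have := hS0 o
        linarith
  linarith

theorem summable_killedProb [Infinite V] (hconn : G.Connected) (hdeg : ∀ z, 0 < G.degree z)
    (htr : Transient G) {Λ : Finset V} {o : V} (ho : o ∈ Λ) (z : V) :
    Summable fun n => killedProb G Λ o n z :=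
  summable_of_sum_range_le (fun n => killedProb_nonneg Λ o n z)
    (fun N => sum_killedProb_le hconn hdeg htr ho N z)

theorem green_nonneg (Λ : Finset V) (o z : V) : 0 ≤ green G Λ o z :=
  tsum_nonneg fun n => killedProb_nonneg Λ o n z

theorem green_le [Infinite V] (hconn : G.Connected) (hdeg : ∀ z, 0 < G.degree z)
    (htr : Transient G) {Λ : Finset V} {o : V} (ho : o ∈ Λ) (z : V) :
    green G Λ o z ≤ ∑' n, walkProb G n o o :=
  Real.tsum_le_of_sum_range_le (fun n => killedProb_nonneg Λ o n z)
    (fun N => sum_killedProb_le hconn hdeg htr ho N z)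

theorem green_of_notMem {Λ : Finset V} {o : V} (ho : o ∈ Λ) {z : V} (hz : z ∉ Λ) :
    green G Λ o z = 0 := by
  simp [green, killedProb_of_notMem ho _ hz]

theorem green_of_mem [Infinite V] (hconn : G.Connected) (hdeg : ∀ z, 0 < G.degree z)
    (htr : Transient G) {Λ : Finset V} {o : V} (ho : o ∈ Λ) {z : V} (hz : z ∈ Λ) :
    green G Λ o z = (if z = o then 1 else 0) + nbrAvg G (green G Λ o) z := by
  have hs := fun y => summable_killedProb hconn hdeg htr ho y
  unfold green
  rw [(hs z).tsum_eq_zero_add]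
  congr 1
  simp only [killedProb, if_pos hz, nbrAvg]
  rw [tsum_div_const, Summable.tsum_finsetSum fun y _ => hs y]

/-! ### The total mass of the Green function -/

theorem walkProb_iso (φ : G ≃g G) (n : ℕ) (x y : V) :
    walkProb G n (φ x) (φ y) = walkProb G n x y := by
  induction n generalizing x with
  | zero => simp [walkProb]
  | succ n ih =>
    simp only [walkProb]
    rw [φ.degree_eq x]
    congr 1
    refine (Finset.sum_bij (fun z _ => φ z) ?_ ?_ ?_ ?_).symm
    · intro z hz
      rw [SimpleGraph.mem_neighborFinset] at hz ⊢
      exact φ.map_adj_iff.2 hz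
    · intro z _ z' _ h
      exact φ.injective h
    · intro w hw
      refine ⟨φ.symm w, ?_, by simp⟩
      rw [SimpleGraph.mem_neighborFinset] at hw ⊢
      rw [← φ.map_adj_iff]
      simpa using hw
    · intro z _
      exact (ih z).symm

/-- The sum runs over starting points, not end points. It equals 1 because constant degree makes the
transition matrix doubly stochastic. -/
theorem exists_sum_walkProb_eq_one (hdeg : ∀ z, 0 < G.degree z) {d : ℕ}
    (hd : ∀ z, G.degree z = d) (o : V) (n : ℕ) :
    ∃ F : Finset V, (∀ z, z ∉ F → walkProb G n z o = 0) ∧ ∑ z ∈ F, walkProb G n z o = 1 := by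
  induction n with
  | zero => exact ⟨{o}, by simp [walkProb], by simp [walkProb]⟩
  | succ n ih =>
    obtain ⟨F, hF0, hF1⟩ := ih
    have hd0 : (0 : ℝ) < d := by exact_mod_cast hd o ▸ hdeg o
    have hsum : ∀ z, ∑ y ∈ G.neighborFinset z, walkProb G n y o =
        ∑ y ∈ F, if G.Adj y z then walkProb G n y o else 0 := by
      intro z
      rw [← Finset.sum_filter, ← Finset.sum_filter_of_ne (s := G.neighborFinset z)
        (p := fun y => y ∈ F) (fun y _ hy => by_contra fun h => hy (hF0 y h))]
      refine Finset.sum_congr ?_ fun _ _ => rfl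
      ext y
      simp [and_comm, G.adj_comm]
    refine ⟨F.biUnion fun y => G.neighborFinset y, ?_, ?_⟩
    · intro z hz
      simp only [walkProb]
      rw [hsum, Finset.sum_eq_zero, zero_div]
      intro y hy
      rw [if_neg]
      intro h
      exact hz (Finset.mem_biUnion.2 ⟨y, hy, by simpa using h⟩)
    · simp only [walkProb, hd, hsum]
      rw [← Finset.sum_div, Finset.sum_comm]
      have : ∀ y ∈ F, (∑ z ∈ F.biUnion fun y => G.neighborFinset y,
          if G.Adj y z then walkProb G n y o else 0) = d * walkProb G n y o := by
        intro y hy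
        rw [← Finset.sum_filter]
        have : (F.biUnion fun y => G.neighborFinset y).filter (fun z => G.Adj y z) =
            G.neighborFinset y := by
          ext z
          simp only [Finset.mem_filter, Finset.mem_biUnion, SimpleGraph.mem_neighborFinset]
          exact ⟨fun h => h.2, fun h => ⟨⟨y, hy, h⟩, h⟩⟩
        rw [this, Finset.sum_const, SimpleGraph.card_neighborFinset_eq_degree, hd, nsmul_eq_mul]
      rw [Finset.sum_congr rfl this, ← Finset.mul_sum, hF1]
      field_simp

/-- If `Λ` contains every point from which `o` is reachable in exactly n steps for some n < `T`, the
killing is invisible at times below `T`, and each such time contributes mass 1. -/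
theorem exists_le_sum_green [Infinite V] (hconn : G.Connected) (hdeg : ∀ z, 0 < G.degree z)
    (htr : Transient G) {d : ℕ} (hd : ∀ z, G.degree z = d) (o : V) (T : ℕ) :
    ∃ Λ : Finset V, o ∈ Λ ∧ (T : ℝ) ≤ ∑ z ∈ Λ, green G Λ o z := by
  choose F hF0 hF1 using exists_sum_walkProb_eq_one hdeg hd o
  set Λ : Finset V := insert o ((Finset.range T).biUnion F) with hΛ
  have ho : o ∈ Λ := Finset.mem_insert_self _ _
  have hsub : ∀ n < T, F n ⊆ Λ := fun n hn z hz =>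
    Finset.mem_insert_of_mem (Finset.mem_biUnion.2 ⟨n, Finset.mem_range.2 hn, hz⟩)
  have hw : ∀ n < T, ∀ z, killedProb G Λ o n z = walkProb G n z o := by
    intro n
    induction n with
    | zero => intro _ z; rfl
    | succ n ih =>
      intro hn z
      simp only [killedProb]
      split_ifs with hz
      · simp only [nbrAvg, walkProb]
        congr 1
        exact Finset.sum_congr rfl fun y _ => ih (by omega) y
      · exact (hF0 (n + 1) z fun h => hz (hsub _ hn h)).symm
  refine ⟨Λ, ho, ?_⟩
  calc (T : ℝ) = ∑ n ∈ Finset.range T, ∑ z ∈ Λ, killedProb G Λ o n z := by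
        rw [Finset.sum_congr rfl (g := fun _ => (1 : ℝ))]
        · simp
        · intro n hn
          rw [← hF1 n]
          rw [Finset.sum_subset (hsub n (Finset.mem_range.1 hn)) fun z _ hz => hF0 n z hz]
          exact Finset.sum_congr rfl fun z _ => hw n (Finset.mem_range.1 hn) z
    _ = ∑ z ∈ Λ, ∑ n ∈ Finset.range T, killedProb G Λ o n z := Finset.sum_comm
    _ ≤ ∑ z ∈ Λ, green G Λ o z := Finset.sum_le_sum fun z _ =>
        (summable_killedProb hconn hdeg htr ho z).sum_le_tsum _
          fun n _ => killedProb_nonneg Λ o n z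

end Green

end

end ARW

/-! ### First and second moments of the number of topplings -/

namespace ARW

noncomputable section

open scoped Classical

/-! ### Moments of the number of topplings -/

section Moments

variable {V : Type*} (G : SimpleGraph V) [G.LocallyFinite] (lam : ℝ)

/-- The expected number of topplings at `o`. -/
def meanVisits (Λ : Set V) (b : V → ℕ) (o : V) (k : ℕ) (η : Config V) : ℝ :=
  stackMean G lam (fun s => (visits Λ b o k s : ℝ)) η

/-- The second moment of the number of topplings at `o`. -/
def meanSqVisits (Λ : Set V) (b : V → ℕ) (o : V) (k : ℕ) (η : Config V) : ℝ :=
  stackMean G lam (fun s => (visits Λ b o k s : ℝ) ^ 2) η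

/-- The probability that `Λ` is stabilized by `k` topplings and ends up in `C`. -/
def stabProb (Λ : Set V) (k : ℕ) (C : Config V → Prop) (η : Config V) : ℝ :=
  stackMean G lam (fun s => if StabIn Λ k C s then 1 else 0) η

/-- One active particle at each site of `s`. -/
def particles (s : Finset V) : Config V := fun z => if z ∈ s then .active 1 else .active 0

variable {G lam}

theorem particles_ne_sleeping (s : Finset V) (z : V) : particles s z ≠ .sleeping := by
  unfold particles
  split_ifs <;> simp

theorem place_particles {s : Finset V} {z : V} (hz : z ∉ s) :
    place (particles s) z = particles (insert z s) := by
  funext w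
  rw [place_apply]
  unfold particles
  by_cases hw : w = z
  · subst hw; simp [hz, SiteState.arrive]
  · simp [hw]

theorem visits_particles_empty (Λ : Set V) (b : V → ℕ) (o : V) (k : ℕ) (τ : Stacks V) :
    visits Λ b o k (particles ∅, τ) = 0 := by
  obtain ⟨α, h1, -, h3⟩ := exists_legal_count_eq Λ b o k (particles ∅, τ)
  rcases α with _ | ⟨z, α⟩
  · simpa using h3.symm
  · have := h1.1.2
    simp [particles, SiteState.numActive] at this

theorem meanVisits_nonneg (Λ : Set V) (b : V → ℕ) (o : V) (k : ℕ) (η : Config V) :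
    0 ≤ meanVisits G lam Λ b o k η :=
  integral_nonneg fun _ => Nat.cast_nonneg _

theorem stabProb_of_stable (hlam : 0 ≤ lam) (hdeg : ∀ z, 0 < G.degree z) {Λ : Set V} {k : ℕ}
    {C : Config V → Prop} {η : Config V} (h : ∀ z ∈ Λ, (η z).numActive = 0) :
    stabProb G lam Λ k C η = if C η then 1 else 0 := by
  unfold stabProb
  rw [← stackMean_const hlam hdeg (if C η then 1 else 0) η]
  unfold stackMean
  congr 1
  funext τ
  simp only [stabIn_iff_of_stable (s := (η, τ)) h]

theorem stabProb_zero {Λ : Set V}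
    {C : Config V → Prop} {η : Config V} {z : V} (hzΛ : z ∈ Λ) (hz : 0 < (η z).numActive) :
    stabProb G lam Λ 0 C η = 0 := by
  have : ∀ τ, ¬ StabIn Λ 0 C (η, τ) := fun τ => not_stabIn_zero (s := (η, τ)) hzΛ hz
  simp [stabProb, stackMean, this]

/-- Comparison with the Green function for a walk that is lazy with probability
`lam / (1 + lam)`. -/
theorem le_add_green [Infinite V] (hconn : G.Connected) (hdeg : ∀ z, 0 < G.degree z)
    (htr : Transient G) (hlam : 0 ≤ lam) {Λ : Finset V} {o : V} (ho : o ∈ Λ) {φ : V → ℝ}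
    {c D : ℝ}
    (hφ : ∀ z ∈ Λ, φ z ≤ (if z = o then 1 else 0) * D +
      (lam / (1 + lam) * φ z + 1 / (1 + lam) * nbrAvg G φ z))
    (hφ0 : ∀ z, z ∉ Λ → φ z ≤ c) (z : V) :
    φ z ≤ c + (1 + lam) * D * green G Λ o z := by
  have key : φ z + (-c) + -((1 + lam) * D) * green G Λ o z ≤ 0 := by
    refine le_zero_of_le_nbrAvg hconn hdeg Λ
      (a := fun z => φ z + (-c) + -((1 + lam) * D) * green G Λ o z) ?_ ?_ z
    · intro y hy
      have h1 := hφ y hy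
      rw [nbrAvg_add, nbrAvg_add, nbrAvg_const hdeg, nbrAvg_const_mul,
        green_of_mem hconn hdeg htr ho hy]
      -- Multiplication by `1 + lam` lets the lazy term cancel and leaves the inequality for the
      -- non-lazy walk.
      have h2 : (1 + lam) * φ y ≤ (1 + lam) * ((if y = o then 1 else 0) * D +
          (lam / (1 + lam) * φ y + 1 / (1 + lam) * nbrAvg G φ y)) := by gcongr
      have h3 : (1 + lam) * ((if y = o then 1 else 0) * D +
          (lam / (1 + lam) * φ y + 1 / (1 + lam) * nbrAvg G φ y)) =
          (1 + lam) * ((if y = o then 1 else 0) * D) + lam * φ y + nbrAvg G φ y := by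
        field_simp
        ring
      rw [h3] at h2
      linarith
    · intro y hy
      rw [green_of_notMem ho hy]
      have := hφ0 y hy
      linarith
  linarith

variable [Countable V]

theorem meanVisits_le_of_legal_imp (hlam : 0 ≤ lam) (hdeg : ∀ z, 0 < G.degree z) {Λ Λ' : Set V}
    {b b' : V → ℕ} {o : V} {k : ℕ} {η η' : Config V}
    (h : ∀ α τ, Legal Λ b α (η, τ) → Legal Λ' b' α (η', τ)) :
    meanVisits G lam Λ b o k η ≤ meanVisits G lam Λ' b' o k η' :=
  stackMean_mono hlam hdeg (bddMeas_visits _ _ _ _) (bddMeas_visits _ _ _ _) fun τ =>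
    Nat.cast_le.2 (visits_le_of_legal_imp fun α => h α τ)

theorem meanSqVisits_le_of_legal_imp (hlam : 0 ≤ lam) (hdeg : ∀ z, 0 < G.degree z)
    {Λ Λ' : Set V} {b b' : V → ℕ} {o : V} {k : ℕ} {η η' : Config V}
    (h : ∀ α τ, Legal Λ b α (η, τ) → Legal Λ' b' α (η', τ)) :
    meanSqVisits G lam Λ b o k η ≤ meanSqVisits G lam Λ' b' o k η' :=
  stackMean_mono hlam hdeg (bddMeas_visits_pow _ _ _ _ 2) (bddMeas_visits_pow _ _ _ _ 2) fun τ => by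
    have : (visits Λ b o k (η, τ) : ℝ) ≤ visits Λ' b' o k (η', τ) :=
      Nat.cast_le.2 (visits_le_of_legal_imp fun α => h α τ)
    gcongr

theorem meanVisits_mono_right (hlam : 0 ≤ lam) (hdeg : ∀ z, 0 < G.degree z) (Λ : Set V)
    (b : V → ℕ) (o : V) (η : Config V) : Monotone fun k => meanVisits G lam Λ b o k η :=
  fun _ _ h => stackMean_mono hlam hdeg (bddMeas_visits _ _ _ _) (bddMeas_visits _ _ _ _) fun _ =>
    Nat.cast_le.2 (visits_mono_right h _)

theorem meanVisits_le_stepMean (hlam : 0 ≤ lam) (hdeg : ∀ z, 0 < G.degree z) {Λ : Set V}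
    {b : V → ℕ} {o : V} {k : ℕ} {η : Config V} {z : V} (hz : 1 ≤ (η z).numActive) :
    meanVisits G lam Λ b o k η ≤ (if z = o then 1 else 0) +
      stepMean G lam z (fun i => meanVisits G lam Λ b o k (perform z i η)) := by
  have hF := bddMeas_visits (V := V) Λ b o k
  have h := stackMean_mono hlam hdeg (η := η) (η' := η) hF
    ((bddMeas_const (if z = o then 1 else 0)).add (hF.comp_topple z)) fun τ => by
      have := visits_le_topple (Λ := Λ) (b := b) (o := o) (k := k) (s := (η, τ)) hz
      split_ifs at this ⊢ <;> exact_mod_cast this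
  rw [stackMean_add hlam hdeg (bddMeas_const _) (hF.comp_topple z), stackMean_const hlam hdeg,
    stackMean_topple hlam hdeg hF] at h
  exact h

theorem stepMean_le_meanVisits (hlam : 0 ≤ lam) (hdeg : ∀ z, 0 < G.degree z) {Λ : Set V}
    {b : V → ℕ} {o : V} {k : ℕ} {η : Config V} {z : V} (hzΛ : z ∈ Λ)
    (hz : b z < (η z).numActive) :
    (if z = o then 1 else 0) +
      stepMean G lam z (fun i => meanVisits G lam Λ b o k (perform z i η)) ≤
    meanVisits G lam Λ b o (k + 1) η := by
  have hF := bddMeas_visits (V := V) Λ b o k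
  have h := stackMean_mono hlam hdeg (η := η) (η' := η)
    ((bddMeas_const (if z = o then 1 else 0)).add (hF.comp_topple z))
    (bddMeas_visits Λ b o (k + 1)) fun τ => by
      have := topple_visits_le (Λ := Λ) (b := b) (o := o) (k := k) (s := (η, τ)) hzΛ hz
      split_ifs at this ⊢ <;> exact_mod_cast this
  rw [stackMean_add hlam hdeg (bddMeas_const _) (hF.comp_topple z), stackMean_const hlam hdeg,
    stackMean_topple hlam hdeg hF] at h
  exact h

/-- With the indicator c of `z = o`, one expands (c + X) ^ 2 and uses c ^ 2 = c. The source term at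
`o` then involves only the first moment. -/
theorem meanSqVisits_le_stepMean (hlam : 0 ≤ lam) (hdeg : ∀ z, 0 < G.degree z) {Λ : Set V}
    {b : V → ℕ} {o : V} {k : ℕ} {η : Config V} {z : V} (hz : 1 ≤ (η z).numActive) :
    meanSqVisits G lam Λ b o k η ≤
      (if z = o then 1 else 0) *
        (1 + 2 * stepMean G lam z (fun i => meanVisits G lam Λ b o k (perform z i η))) +
      stepMean G lam z (fun i => meanSqVisits G lam Λ b o k (perform z i η)) := by
  have hF := (bddMeas_visits (V := V) Λ b o k)
  have hF2 := bddMeas_visits_pow (V := V) Λ b o k 2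
  set c : ℝ := if z = o then 1 else 0 with hc
  have hB := ((bddMeas_const c).add ((hF.comp_topple z).const_mul (2 * c)))
  have h := stackMean_mono hlam hdeg (η := η) (η' := η) hF2 (hB.add (hF2.comp_topple z))
    fun τ => by
      have := visits_le_topple (Λ := Λ) (b := b) (o := o) (k := k) (s := (η, τ)) hz
      have h2 : (visits Λ b o k (η, τ) : ℝ) ≤ c + visits Λ b o k (topple z (η, τ)) := by
        rw [hc]
        split_ifs at this ⊢ <;> exact_mod_cast this
      have hc2 : c ^ 2 = c := by rw [hc]; split_ifs <;> simp
      calc (visits Λ b o k (η, τ) : ℝ) ^ 2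
          ≤ (c + visits Λ b o k (topple z (η, τ))) ^ 2 := by gcongr
        _ = _ := by rw [add_sq, hc2]
  rw [stackMean_add hlam hdeg hB (hF2.comp_topple z),
    stackMean_add hlam hdeg (bddMeas_const _) ((hF.comp_topple z).const_mul _),
    stackMean_const hlam hdeg, stackMean_const_mul, stackMean_topple hlam hdeg hF,
    stackMean_topple hlam hdeg hF2] at h
  refine h.trans (le_of_eq ?_)
  unfold meanVisits meanSqVisits
  ring

theorem stabProb_succ (hlam : 0 ≤ lam) (hdeg : ∀ z, 0 < G.degree z) {Λ : Set V} {k : ℕ}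
    {C : Config V → Prop} {η : Config V} {z : V} (hzΛ : z ∈ Λ) (hz : 0 < (η z).numActive) :
    stabProb G lam Λ (k + 1) C η =
      stepMean G lam z (fun i => stabProb G lam Λ k C (perform z i η)) := by
  have h := stackMean_topple hlam hdeg (bddMeas_stabIn (V := V) Λ k C) z η
  unfold stabProb
  rw [← h]
  unfold stackMean
  congr 1
  funext τ
  simp only [stabIn_succ_iff (s := (η, τ)) hzΛ hz]

theorem stabProb_le_one (hlam : 0 ≤ lam) (hdeg : ∀ z, 0 < G.degree z) (Λ : Set V) (k : ℕ)
    (C : Config V → Prop) (η : Config V) : stabProb G lam Λ k C η ≤ 1 := by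
  rw [← stackMean_const hlam hdeg 1 η]
  exact stackMean_mono hlam hdeg (bddMeas_stabIn Λ k C) (bddMeas_const 1) fun τ => by
    split_ifs <;> simp

/-- The added particle is toppled first: it jumps or, at worst, makes a lazy step. So the mean, as a
function of its position, is bounded by the lazy walk recursion with source 1 at `o`, and outside
`Λ` the particle has no effect. -/
theorem meanVisits_place_le [Infinite V] (hconn : G.Connected) (hdeg : ∀ z, 0 < G.degree z)
    (htr : Transient G) (hlam : 0 ≤ lam) {Λ : Finset V} {o : V} (ho : o ∈ Λ) (b : V → ℕ) (k : ℕ)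
    {η : Config V} (hη : ∀ z, η z ≠ .sleeping) (z : V) :
    meanVisits G lam Λ b o k (place η z) ≤
      meanVisits G lam Λ b o k η + (1 + lam) * green G Λ o z := by
  have := le_add_green hconn hdeg htr hlam ho (D := 1)
    (φ := fun z => meanVisits G lam Λ b o k (place η z)) (c := meanVisits G lam Λ b o k η)
    ?_ ?_ z
  · simpa using this
  · intro y _
    have h := meanVisits_le_stepMean hlam hdeg (Λ := (Λ : Set V)) (b := b) (o := o) (k := k)
      (one_le_numActive_place η y)
    rw [stepMean_eq] at h
    simp only [perform_jump_place (hη y)] at h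
    have h2 : meanVisits G lam Λ b o k (perform y .sleep (place η y)) ≤
        meanVisits G lam Λ b o k (place η y) :=
      meanVisits_le_of_legal_imp hlam hdeg fun α τ hα =>
        hα.mono_config subset_rfl le_rfl fun w _ => rank_perform_sleep_le _ _ _
    have h3 : lam / (1 + lam) * meanVisits G lam Λ b o k (perform y .sleep (place η y)) ≤
        lam / (1 + lam) * meanVisits G lam Λ b o k (place η y) := by gcongr
    unfold nbrAvg
    linarith
  · intro y hy
    refine meanVisits_le_of_legal_imp hlam hdeg fun α τ hα =>
        hα.mono_config subset_rfl le_rfl fun w hw => ?_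
    rw [place_apply, if_neg]
    rintro rfl
    exact hy hw

/-- The same comparison, now with source 1 + 2 * (a bound on the first moment, uniform in the
position of the added particle). -/
theorem meanSqVisits_place_le [Infinite V] (hconn : G.Connected) (hdeg : ∀ z, 0 < G.degree z)
    (htr : Transient G) (hlam : 0 ≤ lam) {Λ : Finset V} {o : V} (ho : o ∈ Λ) (b : V → ℕ) (k : ℕ)
    {η : Config V} (hη : ∀ z, η z ≠ .sleeping) (z : V) :
    meanSqVisits G lam Λ b o k (place η z) ≤ meanSqVisits G lam Λ b o k η +
      (1 + lam) * (1 + 2 * (meanVisits G lam Λ b o k η + (1 + lam) * ∑' n, walkProb G n o o)) *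
        green G Λ o z := by
  set g : ℝ := ∑' n, walkProb G n o o with hg
  have hA : ∀ y, meanVisits G lam Λ b o k (place η y) ≤
      meanVisits G lam Λ b o k η + (1 + lam) * g := fun y => by
    refine (meanVisits_place_le hconn hdeg htr hlam ho b k hη y).trans ?_
    have := green_le hconn hdeg htr ho y
    gcongr
  have hsl : ∀ y w, (perform y .sleep (place η y) w).rank ≤ (place η y w).rank :=
    fun y w => rank_perform_sleep_le _ _ _
  refine le_add_green hconn hdeg htr hlam ho
    (φ := fun z => meanSqVisits G lam Λ b o k (place η z)) ?_ ?_ z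
  · intro y _
    have h := meanSqVisits_le_stepMean hlam hdeg (Λ := (Λ : Set V)) (b := b) (o := o) (k := k)
      (one_le_numActive_place η y)
    have hs : stepMean G lam y (fun i => meanVisits G lam Λ b o k (perform y i (place η y))) ≤
        meanVisits G lam Λ b o k η + (1 + lam) * g := by
      rw [← stepMean_const hlam (hdeg y) (meanVisits G lam Λ b o k η + (1 + lam) * g)]
      refine stepMean_mono hlam ?_ fun u _ => ?_
      · exact (meanVisits_le_of_legal_imp hlam hdeg fun α τ hα =>
          hα.mono_config subset_rfl le_rfl fun w _ => hsl y w).trans (hA y)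
      · rw [perform_jump_place (hη y)]
        exact hA u
    rw [stepMean_eq (h := fun i => meanSqVisits G lam Λ b o k (perform y i (place η y)))] at h
    simp only [perform_jump_place (hη y)] at h
    have h2 : meanSqVisits G lam Λ b o k (perform y .sleep (place η y)) ≤
        meanSqVisits G lam Λ b o k (place η y) :=
      meanSqVisits_le_of_legal_imp hlam hdeg fun α τ hα =>
        hα.mono_config subset_rfl le_rfl fun w _ => hsl y w
    refine h.trans (add_le_add ?_ (add_le_add ?_ le_rfl))
    · have : (0 : ℝ) ≤ if y = o then 1 else 0 := by split_ifs <;> simp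
      gcongr
    · gcongr
  · intro y hy
    refine meanSqVisits_le_of_legal_imp hlam hdeg fun α τ hα =>
        hα.mono_config subset_rfl le_rfl fun w hw => ?_
    rw [place_apply, if_neg]
    rintro rfl
    exact hy hw

theorem meanVisits_particles_le [Infinite V] (hconn : G.Connected) (hdeg : ∀ z, 0 < G.degree z)
    (htr : Transient G) (hlam : 0 ≤ lam) {Λ : Finset V} {o : V} (ho : o ∈ Λ) (b : V → ℕ) (k : ℕ)
    (s : Finset V) :
    meanVisits G lam Λ b o k (particles s) ≤ (1 + lam) * ∑ z ∈ s, green G Λ o z := by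
  induction s using Finset.induction_on with
  | empty => simp [meanVisits, stackMean, visits_particles_empty]
  | insert z s hz ih =>
    have := meanVisits_place_le hconn hdeg htr hlam ho b k (particles_ne_sleeping s) z
    rw [place_particles hz] at this
    rw [Finset.sum_insert hz]
    linarith

theorem meanSqVisits_particles_le [Infinite V] (hconn : G.Connected)
    (hdeg : ∀ z, 0 < G.degree z) (htr : Transient G) (hlam : 0 ≤ lam) {Λ : Finset V} {o : V}
    (ho : o ∈ Λ) (b : V → ℕ) (k : ℕ) (s : Finset V) {K : ℝ} (hK : ∑ z ∈ s, green G Λ o z ≤ K) :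
    meanSqVisits G lam Λ b o k (particles s) ≤
      (1 + lam) * (1 + 2 * ((1 + lam) * K + (1 + lam) * ∑' n, walkProb G n o o)) *
        ∑ z ∈ s, green G Λ o z := by
  induction s using Finset.induction_on with
  | empty => simp [meanSqVisits, stackMean, visits_particles_empty]
  | insert z s hz ih =>
    have h1 := meanSqVisits_place_le hconn hdeg htr hlam ho b k (particles_ne_sleeping s) z
    rw [place_particles hz] at h1
    rw [Finset.sum_insert hz] at hK ⊢
    have hz0 := green_nonneg (G := G) Λ o z
    have h2 := ih (by linarith)
    have h3 := meanVisits_particles_le hconn hdeg htr hlam ho b k s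
    have h4 : meanVisits G lam Λ b o k (particles s) ≤ (1 + lam) * K :=
      h3.trans (by gcongr; linarith)
    refine h1.trans ?_
    rw [mul_add _ (green G Λ o z), add_comm]
    refine add_le_add ?_ h2
    gcongr

end Moments

end

end ARW

/-! ### Rarity of sleepers and the lower bound on the first moment -/

namespace ARW

noncomputable section

open scoped Classical

/-! ### The density of sleeping particles after stabilization -/

section Sleeping

variable {V : Type*} {G : SimpleGraph V} [G.LocallyFinite] {lam : ℝ}

/-- A site that is held is toppled only when it has at least two particles, so no attempt to sleep
there succeeds. -/
theorem perform_ne_sleeping_of_hold {x z : V} {η : Config V} (hx : η x ≠ .sleeping)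
    (hz : (Pi.single x 1 : V → ℕ) z < (η z).numActive) (i : Instruction V) :
    perform z i η x ≠ .sleeping := by
  rw [perform_apply (by omega)]
  by_cases hxz : x = z
  · subst hxz
    rw [Pi.single_eq_same] at hz
    rcases hη : η x with _ | _ | _ | n
    · exact absurd hη hx
    · simp [hη, SiteState.numActive] at hz
    · simp [hη, SiteState.numActive] at hz
    · rcases i with _ | y <;> simp only [siteEffect] <;> split_ifs <;>
        simp [SiteState.trySleep, SiteState.leave, SiteState.arrive]
  · rcases hη : η x with _ | n
    · exact absurd hη hx
    · rcases i with _ | y <;> simp only [siteEffect, if_neg hxz]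
      · simp
      · split_ifs <;> simp [SiteState.arrive]

theorem visits_eq_zero_of_not_ready {Λ : Set V} {b : V → ℕ} {o : V} {k : ℕ} {η : Config V}
    (h : ∀ z ∈ Λ, (η z).numActive ≤ b z) (τ : Stacks V) : visits Λ b o k (η, τ) = 0 := by
  obtain ⟨α, h1, -, h3⟩ := exists_legal_count_eq Λ b o k (η, τ)
  rcases α with _ | ⟨z, α⟩
  · simpa using h3.symm
  · exact absurd h1.1.2 (not_lt.2 (h z h1.1.1))

/-- A toppling at `x` which leaves the last particle asleep is compared with the topplings at `x`
that are possible after all topplings that hold one particle at `x`. -/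
theorem stabProb_add_hold_le [Countable V] (hlam : 0 ≤ lam) (hdeg : ∀ z, 0 < G.degree z)
    {Λ : Set V} {x : V} (j k : ℕ) {η : Config V} (hη : η x ≠ .sleeping) :
    stabProb G lam Λ k (fun ζ => ζ x = .sleeping) η +
        lam / (1 + lam) * meanVisits G lam Λ (Pi.single x 1) x j η ≤
      lam / (1 + lam) * meanVisits G lam Λ 0 x (k + j) η := by
  have hl0 : 0 ≤ lam / (1 + lam) := by positivity
  have hbase : ∀ (k : ℕ) (η : Config V), meanVisits G lam Λ (Pi.single x 1) x j η ≤
      meanVisits G lam Λ 0 x (k + j) η := fun k η =>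
    (meanVisits_le_of_legal_imp hlam hdeg fun α τ hα =>
      hα.mono subset_rfl fun _ => Nat.zero_le _).trans
      (meanVisits_mono_right hlam hdeg Λ 0 x η (Nat.le_add_left j k))
  induction k generalizing η with
  | zero =>
    have h0 : stabProb G lam Λ 0 (fun ζ => ζ x = .sleeping) η = 0 := by
      by_cases hs : ∀ z ∈ Λ, (η z).numActive = 0
      · rw [stabProb_of_stable hlam hdeg hs, if_neg hη]
      · push Not at hs
        obtain ⟨z, hz, hz'⟩ := hs
        exact stabProb_zero hz (Nat.pos_of_ne_zero hz')
    rw [h0, zero_add]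
    exact mul_le_mul_of_nonneg_left (hbase 0 η) hl0
  | succ k ih =>
    -- While a toppling is available that keeps one particle at `x`, it is performed in all three
    -- terms, and the one-step relations carry the claim along.
    by_cases hh : ∃ z ∈ Λ, (Pi.single x 1 : V → ℕ) z < (η z).numActive
    · obtain ⟨z, hz, hz'⟩ := hh
      have h1 := stabProb_succ hlam hdeg (k := k) (C := fun ζ => ζ x = .sleeping) hz
        (lt_of_le_of_lt (Nat.zero_le _) hz')
      have h2 := meanVisits_le_stepMean hlam hdeg (Λ := Λ) (b := Pi.single x 1) (o := x)
        (k := j) (η := η) (z := z) (by omega)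
      have h3 := stepMean_le_meanVisits hlam hdeg (b := 0) (o := x) (k := k + j) hz
        (lt_of_le_of_lt (Nat.zero_le _) hz' : 0 < (η z).numActive)
      have h4 := stepMean_mono (G := G) hlam (z := z)
        (h := fun i => stabProb G lam Λ k (fun ζ => ζ x = .sleeping) (perform z i η) +
          lam / (1 + lam) * meanVisits G lam Λ (Pi.single x 1) x j (perform z i η))
        (h' := fun i => lam / (1 + lam) * meanVisits G lam Λ 0 x (k + j) (perform z i η))
        (ih (perform_ne_sleeping_of_hold hη hz' _))
        (fun y _ => ih (perform_ne_sleeping_of_hold hη hz' _))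
      rw [stepMean_add, stepMean_const_mul, stepMean_const_mul, ← h1] at h4
      have h5 := mul_le_mul_of_nonneg_left h2 hl0
      have h6 := mul_le_mul_of_nonneg_left h3 hl0
      rw [show k + 1 + j = k + j + 1 by omega]
      rw [mul_add] at h5 h6
      linarith
    · push Not at hh
      by_cases hs : ∀ z ∈ Λ, (η z).numActive = 0
      · rw [stabProb_of_stable hlam hdeg hs, if_neg hη, zero_add]
        exact mul_le_mul_of_nonneg_left (hbase (k + 1) η) hl0
      push Not at hs
      obtain ⟨z, hz, hz'⟩ := hs
      -- Now a lone particle at `x` is the only activity in `Λ`. The held count is zero, and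
      -- toppling `x` contributes 1 to the right-hand count, which pays for a sleep of probability
      -- `lam / (1 + lam)`; after a jump the induction hypothesis applies.
      obtain rfl : z = x := by
        by_contra hzx
        have := hh z hz
        rw [Pi.single_eq_of_ne hzx] at this
        omega
      have hz1 : η z = .active 1 := by
        have := hh z hz
        rw [Pi.single_eq_same] at this
        rcases hηz : η z with _ | n
        · exact absurd hηz hη
        · rw [hηz] at this hz'
          simp only [SiteState.numActive] at this hz'
          congr 1
          omega
      have hA : meanVisits G lam Λ (Pi.single z 1) z j η = 0 := by
        simp [meanVisits, stackMean, visits_eq_zero_of_not_ready hh]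
      have hpos : 0 < (η z).numActive := Nat.pos_of_ne_zero hz'
      rw [hA, mul_zero, add_zero, stabProb_succ hlam hdeg hz hpos]
      have h3 := stepMean_le_meanVisits hlam hdeg (b := 0) (o := z) (k := k + j) hz hpos
      rw [if_pos rfl] at h3
      have hjump : ∀ y, G.Adj z y → stabProb G lam Λ k (fun ζ => ζ z = .sleeping)
          (perform z (.jump y) η) ≤
          lam / (1 + lam) * meanVisits G lam Λ 0 z (k + j) (perform z (.jump y) η) := by
        intro y hy
        refine le_trans ?_ (ih (η := perform z (.jump y) η) ?_)
        · exact le_add_of_nonneg_right (mul_nonneg hl0 (meanVisits_nonneg _ _ _ _ _))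
        · rw [perform_apply hpos, hz1]
          simp [siteEffect, hy.ne, SiteState.leave]
      have hstep : stepMean G lam z
          (fun i => stabProb G lam Λ k (fun ζ => ζ z = .sleeping) (perform z i η)) ≤
          lam / (1 + lam) + lam / (1 + lam) *
            stepMean G lam z (fun i => meanVisits G lam Λ 0 z (k + j) (perform z i η)) := by
        rw [← stepMean_const_mul]
        unfold stepMean
        have hq := stabProb_le_one (G := G) hlam hdeg Λ k (fun ζ => ζ z = .sleeping)
          (perform z .sleep η)
        have h0 : 0 ≤ lam / (1 + lam) * (lam / (1 + lam) *
            meanVisits G lam Λ 0 z (k + j) (perform z .sleep η)) :=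
          mul_nonneg hl0 (mul_nonneg hl0 (meanVisits_nonneg _ _ _ _ _))
        have h1 : lam / (1 + lam) * stabProb G lam Λ k (fun ζ => ζ z = .sleeping)
          (perform z .sleep η) ≤ lam / (1 + lam) := mul_le_of_le_one_right hl0 hq
        have h2 : ∑ y ∈ G.neighborFinset z, 1 / (G.degree z * (1 + lam)) *
            stabProb G lam Λ k (fun ζ => ζ z = .sleeping) (perform z (.jump y) η) ≤
            ∑ y ∈ G.neighborFinset z, 1 / (G.degree z * (1 + lam)) *
              (lam / (1 + lam) * meanVisits G lam Λ 0 z (k + j) (perform z (.jump y) η)) := by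
          gcongr with y hy
          exact hjump y (by simpa using hy)
        linarith
      refine hstep.trans ?_
      rw [show k + 1 + j = k + j + 1 by omega]
      have h6 := mul_le_mul_of_nonneg_left h3 hl0
      rw [mul_add, mul_one] at h6
      exact h6

/-- After stabilization, a site holds a sleeping particle with probability at most `lam` times the
Green function. -/
theorem stabProb_sleeping_le [Countable V] [Infinite V] (hconn : G.Connected)
    (hdeg : ∀ z, 0 < G.degree z) (htr : Transient G) (hlam : 0 ≤ lam) {Λ : Finset V} {x : V}
    (hx : x ∈ Λ) (k : ℕ) (s : Finset V) :
    stabProb G lam Λ k (fun ζ => ζ x = .sleeping) (particles s) ≤ lam * green G Λ x x := by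
  have hl0 : 0 ≤ lam / (1 + lam) := by positivity
  set a : ℕ → ℝ := fun j => meanVisits G lam Λ (Pi.single x 1) x j (particles s) with ha
  have hmono : Monotone a := meanVisits_mono_right hlam hdeg _ _ _ _
  have hbdd : BddAbove (Set.range a) := by
    refine ⟨(1 + lam) * ∑ z ∈ s, green G Λ x z, ?_⟩
    rintro _ ⟨j, rfl⟩
    exact meanVisits_particles_le hconn hdeg htr hlam hx _ j s
  have hlim := tendsto_atTop_ciSup hmono hbdd
  -- Topplings without holding are legal with holding once an extra particle sits at `x`, and this
  -- particle costs at most the Green function term.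
  have hA : ∀ n, meanVisits G lam Λ 0 x n (particles s) ≤ a n + (1 + lam) * green G Λ x x :=
    fun n => (meanVisits_le_of_legal_imp hlam hdeg fun α τ hα =>
      hα.hold (particles_ne_sleeping s x)).trans
      (meanVisits_place_le hconn hdeg htr hlam hx _ n (particles_ne_sleeping s) x)
  have hq : ∀ j, stabProb G lam Λ k (fun ζ => ζ x = .sleeping) (particles s) ≤
      lam / (1 + lam) * (a (j + k) - a j + (1 + lam) * green G Λ x x) := by
    intro j
    have h1 := stabProb_add_hold_le hlam hdeg (Λ := (Λ : Set V)) (x := x) j k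
      (particles_ne_sleeping s x)
    have h2 := mul_le_mul_of_nonneg_left (hA (k + j)) hl0
    rw [add_comm j k]
    have : lam / (1 + lam) * (a (k + j) - a j + (1 + lam) * green G Λ x x) =
      lam / (1 + lam) * (a (k + j) + (1 + lam) * green G Λ x x) - lam / (1 + lam) * a j := by ring
    rw [this]
    linarith
  -- The two held counts allow different lengths `j + k` and `j`; they cancel only in the limit,
  -- which exists by monotonicity and boundedness.
  have hT : Tendsto (fun j => lam / (1 + lam) * (a (j + k) - a j + (1 + lam) * green G Λ x x))
      atTop (𝓝 (lam / (1 + lam) * ((⨆ i, a i) - (⨆ i, a i) + (1 + lam) * green G Λ x x))) :=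
    ((((tendsto_add_atTop_iff_nat k).2 hlim).sub hlim).add_const _).const_mul _
  have := ge_of_tendsto' hT hq
  rw [sub_self, zero_add] at this
  refine this.trans (le_of_eq ?_)
  field_simp

/-! ### A lower bound on the expected number of topplings -/

theorem card_siteEffect {z w : V} {a : SiteState} (h : w = z → 1 ≤ a.numActive)
    (i : Instruction V) :
    ((siteEffect z i w a).card : ℝ) = a.card + (match i with
      | .sleep => 0
      | .jump y => (if w = y then 1 else 0) - (if w = z then 1 else 0)) := by
  rcases i with _ | y
  · rcases a with _ | _ | _ | n <;> simp only [siteEffect] <;> split_ifs <;>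
      simp_all [SiteState.card, SiteState.trySleep]
  · rcases a with _ | _ | n <;> simp only [siteEffect] <;> split_ifs <;>
      simp_all [SiteState.card, SiteState.leave, SiteState.arrive, SiteState.numActive]
    all_goals norm_num

/-- Since `f` vanishes off `Λ`, a particle leaving `Λ` needs no separate bookkeeping. -/
theorem sum_card_perform {Λ : Finset V} {f : V → ℝ} (hf : ∀ w, w ∉ Λ → f w = 0) {z : V}
    {η : Config V} (hz : 1 ≤ (η z).numActive) (i : Instruction V) :
    ∑ w ∈ Λ, ((perform z i η w).card : ℝ) * f w = ∑ w ∈ Λ, ((η w).card : ℝ) * f w +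
      (match i with
        | .sleep => 0
        | .jump y => f y - f z) := by
  have h : ∀ w, ((perform z i η w).card : ℝ) = _ := fun w => by
    rw [perform_apply hz, card_siteEffect (fun h => h ▸ hz)]
  simp only [h, add_mul, Finset.sum_add_distrib]
  congr 1
  rcases i with _ | y
  · simp
  · simp only [sub_mul, ite_mul, one_mul, zero_mul, Finset.sum_sub_distrib, Finset.sum_ite_eq']
    congr 1
    · split_ifs with hy
      · rfl
      · exact (hf y hy).symm
    · split_ifs with hy
      · rfl
      · exact (hf z hy).symm

theorem sum_card_perform_le {Λ : Finset V} {z : V} (hzΛ : z ∈ Λ) {η : Config V}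
    (hz : 1 ≤ (η z).numActive) (i : Instruction V) :
    ∑ w ∈ Λ, ((perform z i η w).card : ℝ) ≤ ∑ w ∈ Λ, ((η w).card : ℝ) := by
  have h := sum_card_perform (Λ := Λ) (f := fun w => if w ∈ Λ then 1 else 0)
    (fun w hw => if_neg hw) hz i
  have h' : ∀ ζ : Config V, ∑ w ∈ Λ, ((ζ w).card : ℝ) * (if w ∈ Λ then 1 else 0) =
      ∑ w ∈ Λ, ((ζ w).card : ℝ) := fun ζ =>
    Finset.sum_congr rfl fun w hw => by rw [if_pos hw, mul_one]
  rw [h', h'] at h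
  rw [h]
  refine add_le_of_nonpos_right ?_
  rcases i with _ | y
  · exact le_rfl
  · simp only [hzΛ, if_true]
    split_ifs <;> simp

theorem card_eq_of_stable {a : SiteState} (h : a.numActive = 0) :
    (a.card : ℝ) = if a = .sleeping then 1 else 0 := by
  rcases a with _ | n
  · simp [SiteState.card]
  · simp only [SiteState.numActive] at h
    simp [SiteState.card, h]

/-- By `green_of_mem`, a toppling at `z` in `Λ` changes the potential in mean by -1 / (1 + lam) if
`z = o` and by 0 otherwise. A stable configuration has only the potential of its sleepers; if `k`
topplings do not stabilize, the potential is still at most the bound on `green` times `N`, whence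
the last term. -/
theorem sum_card_green_le [Countable V] [Infinite V] (hconn : G.Connected)
    (hdeg : ∀ z, 0 < G.degree z) (htr : Transient G) (hlam : 0 ≤ lam) {Λ : Finset V} {o : V}
    (ho : o ∈ Λ) {N : ℝ} (k : ℕ) {η : Config V} (hN : ∑ y ∈ Λ, ((η y).card : ℝ) ≤ N) :
    (1 + lam) * ∑ y ∈ Λ, ((η y).card : ℝ) * green G Λ o y ≤
      meanVisits G lam Λ 0 o k η +
        (1 + lam) * ∑ y ∈ Λ,
          green G Λ o y * stabProb G lam Λ k (fun ζ => ζ y = .sleeping) η +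
        (1 + lam) * (∑' n, walkProb G n o o) * N *
          (1 - stabProb G lam Λ k (fun _ => True) η) := by
  set g : ℝ := ∑' n, walkProb G n o o with hg
  have hg0 : 0 ≤ g := tsum_nonneg fun n => walkProb_nonneg n o o
  have stable : ∀ (k : ℕ) (η : Config V), (∀ z ∈ (Λ : Set V), (η z).numActive = 0) →
    (1 + lam) * ∑ y ∈ Λ, ((η y).card : ℝ) * green G Λ o y ≤
      meanVisits G lam Λ 0 o k η +
        (1 + lam) * ∑ y ∈ Λ,
          green G Λ o y * stabProb G lam Λ k (fun ζ => ζ y = .sleeping) η +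
        (1 + lam) * g * N * (1 - stabProb G lam Λ k (fun _ => True) η) := by
    intro k η hs
    rw [stabProb_of_stable hlam hdeg hs, if_pos trivial, sub_self, mul_zero, add_zero]
    refine le_trans (le_of_eq ?_) (le_add_of_nonneg_left (meanVisits_nonneg _ _ _ _ _))
    congr 1
    refine Finset.sum_congr rfl fun y hy => ?_
    rw [stabProb_of_stable hlam hdeg hs, card_eq_of_stable (hs y hy), mul_comm]
  induction k generalizing η with
  | zero =>
    by_cases hs : ∀ z ∈ (Λ : Set V), (η z).numActive = 0
    · exact stable 0 η hs
    · push Not at hs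
      obtain ⟨z, hz, hz'⟩ := hs
      have hp := Nat.pos_of_ne_zero hz'
      simp only [stabProb_zero hz hp, mul_zero, Finset.sum_const_zero, add_zero, sub_zero, mul_one]
      refine le_trans ?_ (le_add_of_nonneg_left (meanVisits_nonneg _ _ _ _ _))
      rw [mul_assoc]
      gcongr
      calc ∑ y ∈ Λ, ((η y).card : ℝ) * green G Λ o y ≤ ∑ y ∈ Λ, ((η y).card : ℝ) * g := by
            gcongr with y hy
            exact green_le hconn hdeg htr ho y
        _ = g * ∑ y ∈ Λ, ((η y).card : ℝ) := by rw [← Finset.sum_mul, mul_comm]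
        _ ≤ g * N := by gcongr
  | succ k ih =>
    by_cases hs : ∀ z ∈ (Λ : Set V), (η z).numActive = 0
    · exact stable (k + 1) η hs
    push Not at hs
    obtain ⟨z, hz, hz'⟩ := hs
    have hp : 0 < (η z).numActive := Nat.pos_of_ne_zero hz'
    have hzΛ : z ∈ Λ := hz
    have hcard : ∀ i, ∑ y ∈ Λ, ((perform z i η y).card : ℝ) ≤ N := fun i =>
      (sum_card_perform_le hzΛ hp i).trans hN
    have hstep := stepMean_mono (G := G) hlam (z := z) (ih (hcard .sleep))
      (h := fun i => (1 + lam) * ∑ y ∈ Λ, ((perform z i η y).card : ℝ) * green G Λ o y)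
      (h' := fun i => meanVisits G lam Λ 0 o k (perform z i η) +
        (1 + lam) * ∑ y ∈ Λ,
          green G Λ o y * stabProb G lam Λ k (fun ζ => ζ y = .sleeping) (perform z i η) +
        (1 + lam) * g * N * (1 - stabProb G lam Λ k (fun _ => True) (perform z i η)))
      (fun y _ => ih (hcard (.jump y)))
    have hA := stepMean_le_meanVisits hlam hdeg (b := 0) (o := o) (k := k) hz hp
    have hΨ : (1 + lam) * stepMean G lam z
        (fun i => ∑ y ∈ Λ, ((perform z i η y).card : ℝ) * green G Λ o y) =
        (1 + lam) * ∑ y ∈ Λ, ((η y).card : ℝ) * green G Λ o y - (if z = o then 1 else 0) := by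
      have h1 : ∀ i, ∑ y ∈ Λ, ((perform z i η y).card : ℝ) * green G Λ o y = _ := fun i =>
        sum_card_perform (fun w hw => green_of_notMem ho hw) hp i
      simp only [h1]
      rw [stepMean_add, stepMean_const hlam (hdeg z), stepMean_eq]
      have h2 : (∑ y ∈ G.neighborFinset z, (green G Λ o y - green G Λ o z)) / G.degree z =
          nbrAvg G (green G Λ o) z - green G Λ o z := by
        have := nbrAvg_add (G := G) (green G Λ o) (fun _ => - green G Λ o z) z
        rw [nbrAvg_const hdeg] at this
        simpa [nbrAvg, sub_eq_add_neg] using this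
      rw [h2]
      have h3 := green_of_mem hconn hdeg htr ho hzΛ
      have h4 : (1 + lam) * (1 / (1 + lam)) = 1 := by field_simp
      rw [mul_zero, zero_add, mul_add, ← mul_assoc, h4]
      linarith
    rw [stepMean_add, stepMean_add, stepMean_const_mul, stepMean_const_mul, stepMean_const_mul, hΨ,
      stepMean_sum] at hstep
    simp only [sub_eq_add_neg, ← neg_one_mul (stabProb _ _ _ _ _ _), stepMean_add,
      stepMean_const_mul, stepMean_const hlam (hdeg z), ← stabProb_succ hlam hdeg hz hp] at hstep ⊢
    linarith

theorem BddMeas.sum {ι : Type*} (t : Finset ι) {F : ι → Config V × Stacks V → ℝ}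
    (hF : ∀ j ∈ t, BddMeas (F j)) : BddMeas fun s => ∑ j ∈ t, F j s := by
  induction t using Finset.induction_on with
  | empty => simpa using bddMeas_const 0
  | insert j t hj ih =>
    simp only [Finset.sum_insert hj]
    exact (hF j (Finset.mem_insert_self _ _)).add
      (ih fun i hi => hF i (Finset.mem_insert_of_mem hi))

/-- It is unlikely that many topplings do not stabilize. -/
theorem one_sub_stabProb_le [Countable V] (hlam : 0 ≤ lam) (hdeg : ∀ z, 0 < G.degree z)
    (Λ : Finset V) (k : ℕ) (η : Config V) :
    (k + 1) * (1 - stabProb G lam Λ k (fun _ => True) η) ≤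
      ∑ x ∈ Λ, meanVisits G lam Λ 0 x (k + 1) η := by
  have hF := fun x => bddMeas_visits (V := V) Λ 0 x (k + 1)
  have hS := (bddMeas_stabIn (V := V) Λ k (fun _ => True)).const_mul (k + 1)
  have h := stackMean_mono hlam hdeg (η := η) (η' := η) (bddMeas_const ((k : ℝ) + 1))
    (hS.add (BddMeas.sum Λ fun x _ => hF x)) fun τ => by
      split_ifs with hst
      · rw [mul_one]
        exact le_add_of_nonneg_right (Finset.sum_nonneg fun _ _ => Nat.cast_nonneg _)
      · obtain ⟨α, h1, h2⟩ := exists_legal_of_not_stabIn hst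
        rw [mul_zero, zero_add]
        have h3 : ∑ x ∈ Λ, α.count x = α.length := by
          have := Multiset.sum_count_eq_card (s := Λ) (m := (α : Multiset V))
            fun x hx => h1.mem (by simpa using hx)
          simpa only [Multiset.coe_count, Multiset.coe_card] using this
        have h4 : ∑ x ∈ Λ, α.count x ≤ ∑ x ∈ Λ, visits Λ 0 x (k + 1) (η, τ) :=
          Finset.sum_le_sum fun x _ => h1.count_le_visits h2.le
        rw [h3, h2] at h4
        exact_mod_cast h4
  rw [stackMean_const hlam hdeg, stackMean_add hlam hdeg hS (BddMeas.sum Λ fun x _ => hF x),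
    stackMean_const_mul] at h
  have h5 : stackMean G lam (fun s => ∑ x ∈ Λ, (visits Λ 0 x (k + 1) s : ℝ)) η =
      ∑ x ∈ Λ, meanVisits G lam Λ 0 x (k + 1) η :=
    integral_finsetSum _ fun x _ => (hF x).integrable hlam hdeg η
  rw [h5] at h
  change (k : ℝ) + 1 ≤ (k + 1) * stabProb G lam Λ k (fun _ => True) η + _ at h
  linarith

theorem sum_card_particles_mul {Λ s : Finset V} (hs : s ⊆ Λ) (f : V → ℝ) :
    ∑ y ∈ Λ, ((particles s y).card : ℝ) * f y = ∑ y ∈ s, f y := by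
  rw [← Finset.sum_subset hs]
  · exact Finset.sum_congr rfl fun y hy => by simp [particles, hy, SiteState.card]
  · intro y _ hy
    simp [particles, hy, SiteState.card]

/-- The expected number of topplings falls short of the one without sleeping by at most the
contribution of a small density of sleeping particles. -/
theorem exists_forall_le_meanVisits [Countable V] [Infinite V] (hconn : G.Connected)
    (hdeg : ∀ z, 0 < G.degree z) (htr : Transient G) (hlam : 0 ≤ lam) {Λ : Finset V} {o : V}
    (ho : o ∈ Λ) {g : ℝ} (hg : ∀ x, ∑' n, walkProb G n x x = g) {ε : ℝ} (hε : 0 < ε) :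
    ∃ k, ∀ s ⊆ Λ, (1 + lam) * (∑ y ∈ s, green G Λ o y - lam * g * ∑ y ∈ Λ, green G Λ o y) - ε ≤
      meanVisits G lam Λ 0 o k (particles s) := by
  have hg0 : 0 ≤ g := hg o ▸ tsum_nonneg fun n => walkProb_nonneg n o o
  set C : ℝ := ∑ x ∈ Λ, (1 + lam) * ∑ y ∈ Λ, green G Λ x y with hC
  set D : ℝ := (1 + lam) * g * Λ.card with hD
  have hC0 : 0 ≤ C := Finset.sum_nonneg fun x _ => mul_nonneg (by linarith)
    (Finset.sum_nonneg fun y _ => green_nonneg Λ x y)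
  have hD0 : 0 ≤ D := by positivity
  -- `C` bounds the mean total number of topplings in `Λ`, so the chance of not being stable after
  -- `k` of them is at most `C / (k + 1)`. This is uniform in `s`, which will be random.
  obtain ⟨k, hk⟩ := exists_nat_gt (D * C / ε)
  refine ⟨k, fun s hs => ?_⟩
  have hN : ∑ y ∈ Λ, ((particles s y).card : ℝ) ≤ Λ.card := by
    have := sum_card_particles_mul hs fun _ => 1
    simp only [mul_one, Finset.sum_const, nsmul_eq_mul] at this
    rw [this]
    exact_mod_cast Finset.card_le_card hs
  have h1 := sum_card_green_le hconn hdeg htr hlam ho k hN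
  rw [sum_card_particles_mul hs, hg, ← hD] at h1
  have h2 := one_sub_stabProb_le hlam hdeg Λ k (particles s)
  have h3 : ∑ x ∈ Λ, meanVisits G lam Λ 0 x (k + 1) (particles s) ≤ C := by
    refine Finset.sum_le_sum fun x hx => ?_
    refine (meanVisits_particles_le hconn hdeg htr hlam hx 0 (k + 1) s).trans ?_
    have := Finset.sum_le_sum_of_subset_of_nonneg (f := green G Λ x) hs
      fun y _ _ => green_nonneg Λ x y
    gcongr
  have h4 : D * (1 - stabProb G lam Λ k (fun _ => True) (particles s)) ≤ ε := by
    have hk' : (0 : ℝ) < k + 1 := by positivity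
    have h5 : 1 - stabProb G lam Λ k (fun _ => True) (particles s) ≤ C / (k + 1) := by
      rw [le_div_iff₀ hk', mul_comm]
      exact h2.trans h3
    calc D * (1 - stabProb G lam Λ k (fun _ => True) (particles s)) ≤ D * (C / (k + 1)) := by
          gcongr
      _ ≤ ε := by
          rw [← mul_div_assoc, div_le_iff₀ hk']
          rw [div_lt_iff₀ hε] at hk
          linarith
  have h6 : ∑ y ∈ Λ, green G Λ o y * stabProb G lam Λ k (fun ζ => ζ y = .sleeping) (particles s) ≤
      lam * g * ∑ y ∈ Λ, green G Λ o y := by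
    rw [Finset.mul_sum]
    refine Finset.sum_le_sum fun y hy => ?_
    have h7 := stabProb_sleeping_le hconn hdeg htr hlam hy k s
    have h8 := green_le hconn hdeg htr hy y
    rw [hg] at h8
    rw [mul_comm]
    refine mul_le_mul_of_nonneg_right (h7.trans ?_) (green_nonneg Λ o y)
    gcongr
  have h9 : (1 + lam) * ∑ y ∈ Λ,
      green G Λ o y * stabProb G lam Λ k (fun ζ => ζ y = .sleeping) (particles s) ≤
      (1 + lam) * (lam * g * ∑ y ∈ Λ, green G Λ o y) := by gcongr
  rw [mul_sub]
  linarith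

end Sleeping

end

end ARW

/-! ### The second moment method -/

namespace ARW

noncomputable section

open scoped Classical

/-! ### Many topplings with positive probability -/

/-- The second moment method. -/
theorem sq_div_le_measureReal_of_sq_le {Ω : Type*} [MeasurableSpace Ω] (ν : Measure Ω)
    [IsProbabilityMeasure ν] {X : Ω → ℝ} (hX : Measurable X) {C m M : ℝ} (hXC : ∀ ω, |X ω| ≤ C)
    (hm : 0 < m) (hM : 0 < M) (h1 : m ≤ ∫ ω, X ω ∂ν) (h2 : ∫ ω, X ω ^ 2 ∂ν ≤ M) :
    m ^ 2 / (4 * M) ≤ ν.real {ω | m / 2 ≤ X ω} := by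
  have hW : MeasurableSet {ω | m / 2 ≤ X ω} := measurableSet_le measurable_const hX
  have hi2 : Integrable (fun ω => X ω ^ 2) ν :=
    Integrable.of_bound (hX.pow_const 2).aestronglyMeasurable (C ^ 2) (ae_of_all _ fun ω => by
      rw [Real.norm_eq_abs, abs_pow]
      gcongr
      exact hXC ω)
  have hi : Integrable X ν := Integrable.of_bound hX.aestronglyMeasurable C (ae_of_all _ hXC)
  have hiW : Integrable ({ω | m / 2 ≤ X ω}.indicator fun _ => (1 : ℝ)) ν :=
    (integrable_const 1).indicator hW
  -- `X` is less than `m / 2` off the event and at most `t / 2 * X ^ 2 + 1 / (2 * t)` on it. This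
  -- `t` makes the quadratic term contribute at most `m / 4`, leaving `m / 4` for the event.
  set t : ℝ := m / (2 * M) with ht
  have ht0 : 0 < t := by positivity
  have hpt : ∀ ω, X ω ≤ m / 2 + (t / 2 * X ω ^ 2 +
      1 / (2 * t) * {ω | m / 2 ≤ X ω}.indicator (fun _ => (1 : ℝ)) ω) := by
    intro ω
    by_cases hω : m / 2 ≤ X ω
    · rw [Set.indicator_of_mem (by exact hω), mul_one]
      have : X ω ≤ t / 2 * X ω ^ 2 + 1 / (2 * t) := by
        rw [← sub_nonneg]
        have : t / 2 * X ω ^ 2 + 1 / (2 * t) - X ω = (t * X ω - 1) ^ 2 / (2 * t) := by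
          field_simp
          ring
        rw [this]
        positivity
      linarith
    · rw [Set.indicator_of_notMem (by exact hω), mul_zero, add_zero]
      have : 0 ≤ t / 2 * X ω ^ 2 := by positivity
      push Not at hω
      linarith
  have h3 := integral_mono hi ((integrable_const (m / 2)).add
    ((hi2.const_mul (t / 2)).add (hiW.const_mul (1 / (2 * t))))) hpt
  rw [integral_add' (integrable_const _) ((hi2.const_mul (t / 2)).add (hiW.const_mul _)),
    integral_add' (hi2.const_mul (t / 2)) (hiW.const_mul _), integral_const_mul,
    integral_const_mul, integral_indicator_const _ hW] at h3
  simp only [integral_const, probReal_univ, smul_eq_mul, one_mul, mul_one] at h3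
  have h4 : t / 2 * ∫ ω, X ω ^ 2 ∂ν ≤ m / 4 := by
    calc t / 2 * ∫ ω, X ω ^ 2 ∂ν ≤ t / 2 * M := by gcongr
      _ = m / 4 := by rw [ht]; field_simp; norm_num
  have h5 : 1 / (2 * t) = M / m := by rw [ht]; field_simp
  rw [h5] at h3
  have h6 : m / 4 ≤ M / m * ν.real {ω | m / 2 ≤ X ω} := by linarith
  rw [div_mul_eq_mul_div, le_div_iff₀ hm] at h6
  rw [div_le_iff₀ (by positivity)]
  nlinarith

section Supercritical

variable {V : Type*} {G : SimpleGraph V} [G.LocallyFinite] {lam : ℝ}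

/-- The law of the set of initially occupied vertices. -/
def siteLaw (V : Type*) (μ : unitInterval) : Measure (V → Bool) :=
  Measure.infinitePi fun _ : V => bernoulliMeasure true false μ

instance (μ : unitInterval) : IsProbabilityMeasure (siteLaw V μ) := by
  unfold siteLaw
  infer_instance

theorem measurable_filter_sites [Countable V] (Λ : Finset V) :
    Measurable[_, ⊤] fun ω : V → Bool => Λ.filter fun z => ω z = true := by
  let _ : MeasurableSpace (Finset V) := ⊤
  refine measurable_to_countable' fun s => ?_
  have : (fun ω : V → Bool => Λ.filter fun z => ω z = true) ⁻¹' {s} =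
      {ω | ∀ z, (z ∈ Λ ∧ ω z = true) ↔ z ∈ s} := by
    ext ω
    simp [Finset.ext_iff]
  rw [this]
  refine measurableSet_setOfPred.2 (Measurable.forall fun z => ?_)
  exact (Measurable.of_discrete (f := fun c : Bool => ((z ∈ Λ ∧ c = true) ↔ z ∈ s))).comp
    (measurable_pi_apply z)

theorem measurable_comp_prod_countable {α β γ δ : Type*} [Countable α] [MeasurableSpace β]
    [MeasurableSpace γ] [MeasurableSpace δ] {F : α → β → δ} (hF : ∀ a, Measurable (F a))
    {f : γ → α} (hf : Measurable[_, ⊤] f) : Measurable fun p : γ × β => F (f p.1) p.2 := by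
  let _ : MeasurableSpace α := ⊤
  have h : Measurable fun q : α × β => F q.1 q.2 := measurable_from_prod_countable_right hF
  exact h.comp ((hf.comp measurable_fst).prodMk measurable_snd)

theorem measurable_visits_particles [Countable V] (Λ : Finset V) (o : V) (k : ℕ) (s : Finset V) :
    Measurable fun τ => (visits (Λ : Set V) 0 o k (particles s, τ) : ℝ) :=
  (bddMeas_visits (V := V) Λ 0 o k).meas (particles s)

theorem measurable_visits_sites [Countable V] (Λ : Finset V) (o : V) (k : ℕ) :
    Measurable fun p : (V → Bool) × Stacks V =>
      (visits Λ 0 o k (particles (Λ.filter fun z => p.1 z = true), p.2) : ℝ) := by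
  have hf := measurable_filter_sites Λ
  have := measurable_comp_prod_countable
    (F := fun s τ => (visits (Λ : Set V) 0 o k (particles s, τ) : ℝ))
    (measurable_visits_particles Λ o k) hf
  exact this

theorem integral_sum_filter_sites (μ : unitInterval) (Λ : Finset V) (f : V → ℝ) :
    Integrable (fun ω : V → Bool => ∑ y ∈ Λ.filter fun z => ω z = true, f y) (siteLaw V μ) ∧
    ∫ ω, ∑ y ∈ Λ.filter fun z => ω z = true, f y ∂siteLaw V μ = μ * ∑ y ∈ Λ, f y := by
  have hi : ∀ y, Integrable (fun ω : V → Bool => if ω y = true then f y else 0)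
      (siteLaw V μ) := fun y => by
    refine Integrable.of_bound (Measurable.aestronglyMeasurable ?_) |f y| (ae_of_all _ fun ω => ?_)
    · exact (Measurable.of_discrete (f := fun c : Bool => if c = true then f y else 0)).comp
        (measurable_pi_apply y)
    · split_ifs <;> simp
  simp only [Finset.sum_filter]
  refine ⟨integrable_finsetSum _ fun y _ => hi y, ?_⟩
  rw [integral_finsetSum _ fun y _ => hi y, Finset.mul_sum]
  refine Finset.sum_congr rfl fun y _ => ?_
  have hmp := measurePreserving_eval_infinitePi
    (fun _ : V => bernoulliMeasure true false μ) y
  have := hmp.hasLaw.integral_comp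
    (f := fun c : Bool => if c = true then f y else 0)
    (Measurable.of_discrete.aestronglyMeasurable)
  rw [integral_bernoulliMeasure] at this
  simpa [Function.comp_def, siteLaw] using this

/-- The lower bound on the probability does not depend on `K`: first moment squared and second
moment both scale like the square of the Green mass. -/
theorem exists_measurableSet_many_topplings [Countable V] [Infinite V] (hconn : G.Connected)
    (hdeg : ∀ z, 0 < G.degree z) (htr : Transient G) {d : ℕ} (hd : ∀ z, G.degree z = d)
    (hlam : 0 < lam) {g : ℝ} (hg : ∀ x, ∑' n, walkProb G n x x = g) (hg1 : 0 < g)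
    {μ : unitInterval} (hμ : (μ : ℝ) = 2 * lam * g) (o : V) (K : ℕ) :
    ∃ W : Set ((V → Bool) × Stacks V), MeasurableSet W ∧
      lam ^ 2 * g ^ 2 / (16 * ((1 + lam) * (1 + 2 * (1 + lam) * (1 + g)))) ≤
        ((siteLaw V μ).prod (stackLaw G lam)).real W ∧
      ∀ p ∈ W, ∃ α, Legal Set.univ 0 α
        ((fun x => if p.1 x then .active 1 else .active 0 : Config V), p.2) ∧ K ≤ α.count o := by
  have hS := isProbabilityMeasure_stackLaw hlam.le hdeg
  -- The topplings found will number at least `lam * g * S / 4`, which must reach `K`. The summand 1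
  -- ensures `S ≥ 1`, so that linear terms are absorbed in `S ^ 2`.
  obtain ⟨T, hT⟩ := exists_nat_ge (1 + 4 * K / (lam * g))
  obtain ⟨Λ, ho, hΛ⟩ := exists_le_sum_green hconn hdeg htr hd o T
  set S : ℝ := ∑ z ∈ Λ, green G Λ o z with hSdef
  have hlg : 0 < lam * g := by positivity
  have hKS : 1 + 4 * K / (lam * g) ≤ S := hT.trans hΛ
  have hS1 : 1 ≤ S := by
    have : 0 ≤ 4 * (K : ℝ) / (lam * g) := by positivity
    linarith
  -- Of the mean potential `2 * lam * g * S`, sleepers take at most half; this error takes another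
  -- `lam * g * S / 2` and leaves that much.
  obtain ⟨k, hk⟩ := exists_forall_le_meanVisits hconn hdeg htr hlam.le ho hg
    (ε := lam * g * S / 2) (by positivity)
  set ν := (siteLaw V μ).prod (stackLaw G lam) with hν
  set X : (V → Bool) × Stacks V → ℝ := fun p =>
    (visits Λ 0 o k (particles (Λ.filter fun z => p.1 z = true), p.2) : ℝ) with hX
  have hXm : Measurable X := measurable_visits_sites Λ o k
  have hXC : ∀ p, |X p| ≤ (k : ℝ) := fun p => by
    rw [abs_of_nonneg (Nat.cast_nonneg _)]
    exact Nat.cast_le.2 (visits_le _)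
  have hXi : Integrable X ν := Integrable.of_bound hXm.aestronglyMeasurable k (ae_of_all _ hXC)
  have hX2i : Integrable (fun p => X p ^ 2) ν :=
    Integrable.of_bound (hXm.pow_const 2).aestronglyMeasurable ((k : ℝ) ^ 2)
      (ae_of_all _ fun p => by
        rw [Real.norm_eq_abs, abs_pow]
        gcongr
        exact hXC p)
  obtain ⟨hsi, hsum⟩ := integral_sum_filter_sites μ Λ (green G Λ o)
  have h1 : lam * g * S / 2 ≤ ∫ p, X p ∂ν := by
    rw [hν, integral_prod _ hXi]
    have hmono := integral_mono (((hsi.sub (integrable_const (lam * g * S))).const_mul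
      (1 + lam)).sub (integrable_const (lam * g * S / 2))) hXi.integral_prod_left
      (fun ω => hk _ (Finset.filter_subset (fun z => ω z = true) Λ))
    refine le_trans ?_ hmono
    rw [integral_sub' ((hsi.sub (integrable_const _)).const_mul _) (integrable_const _),
      integral_const_mul, integral_sub' hsi (integrable_const _), hsum, ← hSdef, hμ]
    simp only [integral_const, probReal_univ, smul_eq_mul, one_mul]
    have : 0 ≤ lam * (lam * g * S) := by positivity
    linarith
  set C : ℝ := (1 + lam) * (1 + 2 * (1 + lam) * (1 + g)) with hC
  have hC0 : 0 < C := by positivity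
  have h2 : ∫ p, X p ^ 2 ∂ν ≤ C * S ^ 2 := by
    rw [hν, integral_prod _ hX2i]
    have hb : ∀ ω : V → Bool, ∫ τ, X (ω, τ) ^ 2 ∂stackLaw G lam ≤ C * S ^ 2 := by
      intro ω
      have hsub := Finset.filter_subset (fun z => ω z = true) Λ
      have hle : ∑ z ∈ Λ.filter (fun z => ω z = true), green G Λ o z ≤ S :=
        Finset.sum_le_sum_of_subset_of_nonneg hsub fun y _ _ => green_nonneg Λ o y
      refine (meanSqVisits_particles_le hconn hdeg htr hlam.le ho 0 k _ hle).trans ?_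
      rw [hg]
      calc (1 + lam) * (1 + 2 * ((1 + lam) * S + (1 + lam) * g)) *
            ∑ z ∈ Λ.filter (fun z => ω z = true), green G Λ o z
          ≤ (1 + lam) * (S + 2 * ((1 + lam) * S + (1 + lam) * (g * S))) * S := by
            have := le_mul_of_one_le_right hg1.le hS1
            have := Finset.sum_nonneg fun (z : V) (_ : z ∈ Λ.filter fun z => ω z = true) =>
              green_nonneg (G := G) Λ o z
            gcongr
        _ = C * S ^ 2 := by rw [hC]; ring
    refine (integral_mono hX2i.integral_prod_left (integrable_const _) hb).trans ?_
    simp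
  have h3 := sq_div_le_measureReal_of_sq_le ν hXm hXC (by positivity) (by positivity) h1 h2
  refine ⟨{p | lam * g * S / 2 / 2 ≤ X p}, measurableSet_le measurable_const hXm, ?_, ?_⟩
  · refine le_trans (le_of_eq ?_) h3
    field_simp
    ring
  · rintro ⟨ω, τ⟩ hp
    obtain ⟨α, hα1, -, hα3⟩ := exists_legal_count_eq (Λ : Set V) 0 o k
      (particles (Λ.filter fun z => ω z = true), τ)
    refine ⟨α, hα1.mono_config (Set.subset_univ _) le_rfl fun w hw => ?_, ?_⟩
    · simp only [particles, Finset.mem_filter, show w ∈ Λ from hw, true_and]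
      exact le_rfl
    · rw [hα3]
      have hp' : lam * g * S / 2 / 2 ≤
          (visits Λ 0 o k (particles (Λ.filter fun z => ω z = true), τ) : ℝ) := hp
      have h4 : (K : ℝ) ≤ lam * g * S / 2 / 2 := by
        have h5 : 4 * K / (lam * g) ≤ S := by linarith
        rw [div_le_iff₀ hlg] at h5
        linarith
      exact_mod_cast h4.trans hp'

/-- With positive probability there is no bound on the number of topplings at a vertex. -/
theorem sampleLaw_unbounded_topplings_pos [Countable V] [Infinite V] (hconn : G.Connected)
    (hdeg : ∀ z, 0 < G.degree z) (htr : Transient G) {d : ℕ} (hd : ∀ z, G.degree z = d)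
    (hlam : 0 < lam) {g : ℝ} (hg : ∀ x, ∑' n, walkProb G n x x = g) (hg1 : 0 < g)
    {μ : unitInterval} (hμ : (μ : ℝ) = 2 * lam * g) (o : V) :
    0 < sampleLaw G lam μ
      {ω | ∀ K, ∃ α, Legal Set.univ 0 α (initialConfig ω, ω.2.1) ∧ K ≤ α.count o} := by
  have hS := isProbabilityMeasure_stackLaw hlam.le hdeg
  choose W hWm hWc hW using
    exists_measurableSet_many_topplings hconn hdeg htr hd hlam hg hg1 hμ o
  set c : ℝ := lam ^ 2 * g ^ 2 / (16 * ((1 + lam) * (1 + 2 * (1 + lam) * (1 + g)))) with hc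
  have hc0 : 0 < c := by positivity
  set ν := (siteLaw V μ).prod (stackLaw G lam) with hν
  -- The events `W` need not be nested. Their limsup retains the uniform lower bound, and on it
  -- every `K` is exceeded.
  set D : ℕ → Set ((V → Bool) × Stacks V) := fun n => ⋃ K, W (n + K) with hD
  have hDm : ∀ n, MeasurableSet (D n) := fun n => MeasurableSet.iUnion fun K => hWm _
  have hanti : Antitone D := by
    intro n m h
    refine Set.iUnion_subset fun K => ?_
    refine Set.subset_iUnion_of_subset (m - n + K) ?_
    rw [show n + (m - n + K) = m + K by omega]
  have hlim := tendsto_measure_iInter_atTop (μ := ν) (fun n => (hDm n).nullMeasurableSet) hanti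
    ⟨0, measure_ne_top _ _⟩
  have hge : ENNReal.ofReal c ≤ ν (⋂ n, D n) := by
    refine ge_of_tendsto' hlim fun n => ?_
    calc ENNReal.ofReal c ≤ ENNReal.ofReal (ν.real (W n)) := ENNReal.ofReal_le_ofReal (hWc n)
      _ = ν (W n) := ofReal_measureReal
      _ ≤ ν (D n) := measure_mono (Set.subset_iUnion_of_subset 0 subset_rfl)
  have hexp := isProbabilityMeasure_expMeasure (show 0 < 1 + lam by linarith)
  have hSE : IsProbabilityMeasure ((stackLaw G lam).prod
      (Measure.infinitePi fun _ : V × ℕ × ℕ => expMeasure (1 + lam))) := inferInstance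
  have hmp : MeasurePreserving (fun ω : Sample V => (ω.1, ω.2.1)) (sampleLaw G lam μ) ν :=
    (MeasurePreserving.id (siteLaw V μ)).prod (μc := (stackLaw G lam).prod
      (Measure.infinitePi fun _ : V × ℕ × ℕ => expMeasure (1 + lam))) (measurePreserving_fst (μ := stackLaw G lam)
      (ν := Measure.infinitePi fun _ : V × ℕ × ℕ => expMeasure (1 + lam)))
  rw [← hmp.measure_preimage (MeasurableSet.iInter hDm).nullMeasurableSet] at hge
  refine lt_of_lt_of_le (ENNReal.ofReal_pos.2 hc0) (hge.trans (measure_mono ?_))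
  intro ω hω K
  obtain ⟨j, hj⟩ := Set.mem_iUnion.1 (Set.mem_iInter.1 hω K)
  obtain ⟨α, h1, h2⟩ := hW _ _ hj
  exact ⟨α, h1, by omega⟩

end Supercritical

end

end ARW

/-! ### From continuous time to legal lists -/

namespace ARW

noncomputable section

open scoped Classical

/-! ### The dynamics as a legal list of topplings -/

section Dynamics

variable {V : Type*}

theorem initialConfig_card_le (ω : Sample V) (x : V) : (initialConfig ω x).card ≤ 1 := by
  unfold initialConfig
  split_ifs <;> simp [SiteState.card]

theorem numActive_le_card (a : SiteState) : a.numActive ≤ a.card := by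
  rcases a with _ | n <;> simp [SiteState.card, SiteState.numActive]

/-- The ring times of the first `N` clocks at `x` up to time `t`. -/
def ringSet (ω : Sample V) (x : V) (N : ℕ) (t : ℝ) : Set EReal :=
  {r | ∃ i < N, ∃ n, r = (ringTime ω x i n : EReal) ∧ ringTime ω x i n ≤ t}

theorem finite_ringSet {ω : Sample V} (hω : ∀ x i, Tendsto (ringTime ω x i) atTop atTop) (x : V)
    (N : ℕ) (t : ℝ) : (ringSet ω x N t).Finite := by
  have h : ∀ i, {n | ringTime ω x i n ≤ t}.Finite := fun i => by
    obtain ⟨m, hm⟩ := eventually_atTop.1 ((hω x i).eventually_gt_atTop t)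
    refine (Set.finite_lt_nat m).subset fun n hn => ?_
    by_contra h
    exact absurd (hm n (not_lt.1 h)) (not_lt.2 hn)
  refine ((Set.finite_lt_nat N).biUnion fun i _ =>
    (h i).image fun n => (ringTime ω x i n : EReal)).subset ?_
  rintro r ⟨i, hi, n, rfl, hn⟩
  exact Set.mem_biUnion hi ⟨n, hn, rfl⟩

/-- The next ring is attained as long as there is an active particle. -/
theorem exists_nextRing_eq {ω : Sample V} (hω : ∀ x i, Tendsto (ringTime ω x i) atTop atTop)
    {Λ : Finset V} {S : Stage V} (hS : S.time ≠ ⊤) {z : V} (hz : z ∈ Λ)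
    (ha : 0 < (S.config z).numActive) :
    S.time < nextRing ω Λ S ∧ ∃ x ∈ Λ, ∃ i < (S.config x).numActive, ∃ n : ℕ,
      nextRing ω Λ S = (ringTime ω x i n : EReal) := by
  set R : Set EReal := {r : EReal | S.time < r ∧
    ∃ x ∈ Λ, ∃ i < (S.config x).numActive, ∃ n : ℕ, r = (ringTime ω x i n : EReal)} with hR
  obtain ⟨c, hc, -⟩ := EReal.lt_iff_exists_real_btwn.1 (lt_top_iff_ne_top.2 hS)
  obtain ⟨m, hm⟩ := eventually_atTop.1 ((hω z 0).eventually_gt_atTop c)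
  set t := ringTime ω z 0 m with ht
  have htR : (t : EReal) ∈ R :=
    ⟨hc.trans (EReal.coe_lt_coe_iff.2 (hm m le_rfl)), z, hz, 0, ha, m, rfl⟩
  have hfin : (R ∩ Set.Iic (t : EReal)).Finite := by
    refine (Λ.finite_toSet.biUnion fun x _ =>
      finite_ringSet hω x (S.config x).numActive t).subset ?_
    rintro r ⟨⟨-, x, hx, i, hi, n, rfl⟩, hr⟩
    exact Set.mem_biUnion hx ⟨i, hi, n, rfl, EReal.coe_le_coe_iff.1 hr⟩
  obtain ⟨r, hr, hmin⟩ := Set.exists_min_image _ id hfin ⟨_, htR, le_refl (t : EReal)⟩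
  have hleast : IsLeast R r := by
    refine ⟨hr.1, fun u hu => ?_⟩
    rcases le_total u t with h | h
    · exact hmin u ⟨hu, h⟩
    · exact le_trans hr.2 h
  have hEq : nextRing ω Λ S = r := hleast.csInf_eq
  rw [hEq]
  exact hr.1

/-- The stacks after `u x` instructions have been used at each `x`. -/
def dropUsed (τ : Stacks V) (u : V → ℕ) : Stacks V := fun p => τ (p.1, p.2 + u p.1)

theorem topple_dropUsed (z : V) (η : Config V) (τ : Stacks V) (u : V → ℕ) :
    topple z (η, dropUsed τ u) =
      (perform z (τ (z, u z)) η, dropUsed τ (Function.update u z (u z + 1))) := by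
  refine Prod.ext ?_ ?_
  · simp [topple, dropUsed]
  · funext ⟨w, n⟩
    by_cases h : w = z
    · subst h
      simp only [topple, tailAt, dropUsed, if_true, Function.update_self]
      congr 2
      omega
    · simp [topple, tailAt, dropUsed, h]

/-- A step in which the vertex `z` uses an instruction. -/
def IsMove (ω : Sample V) (Λ : Finset V) (S S' : Stage V) (z : V) : Prop :=
  z ∈ Λ ∧ (∃ i < (S.config z).numActive, ∃ n, S'.time = (ringTime ω z i n : EReal)) ∧
    S.time < S'.time ∧ S'.config = perform z (ω.2.1 (z, S.used z)) S.config ∧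
    S'.used = Function.update S.used z (S.used z + 1)

/-- A step without effect, after stabilization. -/
def IsStop (Λ : Finset V) (S S' : Stage V) : Prop :=
  (∀ z ∈ Λ, (S.config z).numActive = 0) ∧ S'.config = S.config ∧ S'.used = S.used ∧ S'.time = ⊤

/-- Only these properties of the chosen vertex are used later, so simultaneous rings need not be
excluded. -/
theorem isMove_or_isStop_nextStage {ω : Sample V}
    (hω : ∀ x i, Tendsto (ringTime ω x i) atTop atTop) {Λ : Finset V} {S : Stage V}
    (hS : S.time = ⊤ → ∀ z ∈ Λ, (S.config z).numActive = 0) :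
    (∃ z, IsMove ω Λ S (nextStage ω Λ S) z) ∨ IsStop Λ S (nextStage ω Λ S) := by
  by_cases hst : ∀ z ∈ Λ, (S.config z).numActive = 0
  · right
    have hempty : {r : EReal | S.time < r ∧
        ∃ x ∈ Λ, ∃ i < (S.config x).numActive, ∃ n : ℕ, r = (ringTime ω x i n : EReal)} = ∅ := by
      refine Set.eq_empty_of_forall_notMem ?_
      rintro r ⟨-, x, hx, i, hi, -⟩
      rw [hst x hx] at hi
      exact absurd hi (Nat.not_lt_zero _)
    have htop : nextRing ω Λ S = ⊤ := by
      unfold nextRing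
      rw [hempty, sInf_empty]
    have hno : ¬ ∃ x ∈ Λ, ∃ i < (S.config x).numActive, ∃ n : ℕ,
        nextRing ω Λ S = (ringTime ω x i n : EReal) := by
      rintro ⟨x, hx, i, hi, -⟩
      rw [hst x hx] at hi
      exact absurd hi (Nat.not_lt_zero _)
    unfold nextStage
    rw [dif_neg hno]
    exact ⟨hst, rfl, rfl, htop⟩
  · left
    push Not at hst
    obtain ⟨z, hz, ha⟩ := hst
    have htime : S.time ≠ ⊤ := fun h => ha (hS h z hz)
    obtain ⟨hlt, h⟩ := exists_nextRing_eq hω htime hz (Nat.pos_of_ne_zero ha)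
    refine ⟨h.choose, ?_⟩
    unfold nextStage
    rw [dif_pos h]
    exact ⟨h.choose_spec.1, h.choose_spec.2, hlt, rfl, rfl⟩

variable {ω : Sample V} {Λ : Finset V}

theorem stage_succ (ω : Sample V) (Λ : Finset V) (k : ℕ) :
    stage ω Λ (k + 1) = nextStage ω Λ (stage ω Λ k) :=
  Function.iterate_succ_apply' _ _ _

theorem stage_stable_of_time_eq_top (hω : ∀ x i, Tendsto (ringTime ω x i) atTop atTop) (k : ℕ) :
    (stage ω Λ k).time = ⊤ → ∀ z ∈ Λ, ((stage ω Λ k).config z).numActive = 0 := by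
  induction k with
  | zero => intro h; exact absurd h EReal.zero_ne_top
  | succ k ih =>
    rw [stage_succ]
    rcases isMove_or_isStop_nextStage hω ih with ⟨z, -, ⟨i, -, n, h⟩, -⟩ | ⟨h1, h2, -⟩
    · rw [h]
      intro h'
      exact absurd h' (EReal.coe_ne_top _)
    · rw [h2]
      exact fun _ => h1

theorem isMove_or_isStop (hω : ∀ x i, Tendsto (ringTime ω x i) atTop atTop) (k : ℕ) :
    (∃ z, IsMove ω Λ (stage ω Λ k) (stage ω Λ (k + 1)) z) ∨
      IsStop Λ (stage ω Λ k) (stage ω Λ (k + 1)) := by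
  rw [stage_succ]
  exact isMove_or_isStop_nextStage hω (stage_stable_of_time_eq_top hω k)

theorem monotone_stage_time (hω : ∀ x i, Tendsto (ringTime ω x i) atTop atTop) :
    Monotone fun k => (stage ω Λ k).time := by
  refine monotone_nat_of_le_succ fun k => ?_
  rcases isMove_or_isStop hω k with ⟨z, -, -, h, -⟩ | ⟨-, -, -, h⟩
  · exact h.le
  · rw [h]
    exact le_top

theorem exists_stage_time_eq (hω : ∀ x i, Tendsto (ringTime ω x i) atTop atTop) {k : ℕ}
    (hk : (stage ω Λ k).time ≠ ⊤) : ∃ s : ℝ, 0 ≤ s ∧ (stage ω Λ k).time = s := by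
  have h0 : (0 : EReal) ≤ (stage ω Λ k).time := monotone_stage_time hω (Nat.zero_le k)
  lift (stage ω Λ k).time to ℝ using ⟨hk, fun h => by rw [h] at h0; simp at h0⟩ with s hs
  exact ⟨s, by exact_mod_cast h0, rfl⟩

theorem sum_card_stage_le (hω : ∀ x i, Tendsto (ringTime ω x i) atTop atTop) (k : ℕ) :
    ∑ x ∈ Λ, (((stage ω Λ k).config x).card : ℝ) ≤ Λ.card := by
  induction k with
  | zero =>
    have : ∑ x ∈ Λ, ((initialConfig ω x).card : ℝ) ≤ ∑ x ∈ Λ, 1 :=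
      Finset.sum_le_sum fun x _ => by exact_mod_cast initialConfig_card_le ω x
    simpa [stage] using this
  | succ k ih =>
    rcases isMove_or_isStop hω k with ⟨z, hz, ⟨i, hi, -⟩, -, h, -⟩ | ⟨-, h, -⟩
    · rw [h]
      exact (sum_card_perform_le hz (by omega) _).trans ih
    · rw [h]
      exact ih

theorem numActive_stage_le (hω : ∀ x i, Tendsto (ringTime ω x i) atTop atTop) (k : ℕ) {x : V}
    (hx : x ∈ Λ) : ((stage ω Λ k).config x).numActive ≤ Λ.card := by
  have h1 := sum_card_stage_le (Λ := Λ) hω k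
  have h2 : (((stage ω Λ k).config x).card : ℝ) ≤
      ∑ x ∈ Λ, (((stage ω Λ k).config x).card : ℝ) :=
    Finset.single_le_sum (f := fun x => (((stage ω Λ k).config x).card : ℝ))
      (fun _ _ => Nat.cast_nonneg _) hx
  exact (numActive_le_card _).trans (by exact_mod_cast h2.trans h1)

/-- The stages are obtained by a legal list of topplings. -/
theorem exists_legal_run_eq_stage (hω : ∀ x i, Tendsto (ringTime ω x i) atTop atTop) (k : ℕ) :
    ∃ β, Legal Λ 0 β (initialConfig ω, ω.2.1) ∧
      run β (initialConfig ω, ω.2.1) =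
        ((stage ω Λ k).config, dropUsed ω.2.1 (stage ω Λ k).used) ∧
      ∀ o, β.count o = (stage ω Λ k).used o := by
  induction k with
  | zero => exact ⟨[], trivial, rfl, fun o => rfl⟩
  | succ k ih =>
    obtain ⟨β, h1, h2, h3⟩ := ih
    rcases isMove_or_isStop hω k with ⟨z, hz, ⟨i, hi, -⟩, -, hc, hu⟩ | ⟨-, hc, hu, -⟩
    · refine ⟨β ++ [z], (legal_append _ _ _).2 ⟨h1, ?_⟩, ?_, ?_⟩
      · rw [h2]
        exact ⟨⟨hz, lt_of_le_of_lt (Nat.zero_le _) hi⟩, trivial⟩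
      · rw [run_append, h2, hc, hu]
        exact topple_dropUsed _ _ _ _
      · intro o
        rw [List.count_append, h3, hu, List.count_singleton, Function.update_apply]
        by_cases h : o = z
        · subst h; simp
        · simp [h, Ne.symm h]
    · rw [hc, hu]
      exact ⟨β, h1, h2, h3⟩

/-- Only finitely many instructions are used up to a given time. -/
theorem bddAbove_stage_time_le (hω : ∀ x i, Tendsto (ringTime ω x i) atTop atTop) (t : ℝ) :
    BddAbove {k : ℕ | (stage ω Λ k).time ≤ (t : EReal)} := by
  have hfin : (⋃ x ∈ (Λ : Set V), ringSet ω x Λ.card t).Finite :=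
    Λ.finite_toSet.biUnion fun x _ => finite_ringSet hω x _ t
  set F := hfin.toFinset with hF
  -- Each move happens strictly later than the one before, at a time in `F`. This set is finite
  -- since at most `Λ.card` clocks per site ever matter.
  have key : ∀ k, (stage ω Λ k).time ≤ (t : EReal) →
      k ≤ (F.filter fun r => r ≤ (stage ω Λ k).time).card := by
    intro k
    induction k with
    | zero => exact fun _ => Nat.zero_le _
    | succ k ih =>
      intro hk
      rcases isMove_or_isStop hω k with ⟨z, hz, ⟨i, hi, n, hn⟩, hlt, -⟩ | ⟨-, -, -, h⟩
      · have h1 := ih (hlt.le.trans hk)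
        have hmem : (stage ω Λ (k + 1)).time ∈ F := by
          rw [hF, Set.Finite.mem_toFinset]
          refine Set.mem_biUnion hz ⟨i, hi.trans_le (numActive_stage_le hω k hz), n, hn, ?_⟩
          rw [hn] at hk
          exact EReal.coe_le_coe_iff.1 hk
        refine Nat.succ_le_of_lt (h1.trans_lt (Finset.card_lt_card ?_))
        refine Finset.ssubset_iff_of_subset ?_ |>.2 ⟨(stage ω Λ (k + 1)).time, ?_, ?_⟩
        · intro r hr
          rw [Finset.mem_filter] at hr ⊢
          exact ⟨hr.1, hr.2.trans hlt.le⟩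
        · exact Finset.mem_filter.2 ⟨hmem, le_rfl⟩
        · exact fun h => absurd (Finset.mem_filter.1 h).2 (not_le.2 hlt)
      · rw [h] at hk
        exact absurd hk (not_le.2 (EReal.coe_lt_top t))
  exact ⟨F.card, fun k hk => (key k hk).trans (Finset.card_filter_le _ _)⟩

theorem finiteARW_eq_of_time (hω : ∀ x i, Tendsto (ringTime ω x i) atTop atTop) {j : ℕ} {s : ℝ}
    (h1 : (stage ω Λ j).time ≤ (s : EReal)) (h2 : (s : EReal) < (stage ω Λ (j + 1)).time) :
    finiteARW ω Λ s = (stage ω Λ j).config := by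
  have : {k : ℕ | (stage ω Λ k).time ≤ (s : EReal)} = Set.Iic j := by
    ext k
    constructor
    · intro hk
      by_contra hkj
      have := monotone_stage_time (Λ := Λ) hω (Nat.succ_le_of_lt (not_le.1 hkj))
      exact absurd (h2.trans_le (this.trans hk)) (lt_irrefl _)
    · intro hk
      exact (monotone_stage_time hω hk).trans h1
  rw [finiteARW, this, csSup_Iic]

/-- Boundedness matters here: in `ℕ` the `sSup` of an unbounded set is 0, and `finiteARW` would then
return the initial configuration. -/
theorem exists_stage_eq_finiteARW (hω : ∀ x i, Tendsto (ringTime ω x i) atTop atTop) {t : ℝ}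
    (ht : 0 ≤ t) :
    ∃ k, (stage ω Λ k).time ≤ (t : EReal) ∧ finiteARW ω Λ t = (stage ω Λ k).config :=
  ⟨_, Nat.sSup_mem ⟨0, by simpa [stage] using ht⟩ (bddAbove_stage_time_le hω t), rfl⟩

/-- Times of moves strictly increase, so the instructions used at `o` correspond to distinct
elements of `F`. -/
theorem used_stage_le (hω : ∀ x i, Tendsto (ringTime ω x i) atTop atTop) {o : V}
    {F : Finset EReal} (k : ℕ)
    (hF : ∀ j < k, IsMove ω Λ (stage ω Λ j) (stage ω Λ (j + 1)) o →
      (stage ω Λ (j + 1)).time ∈ F) :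
    (stage ω Λ k).used o ≤ (F.filter fun r => r ≤ (stage ω Λ k).time).card := by
  induction k with
  | zero => exact Nat.zero_le _
  | succ k ih =>
    have h1 := ih fun j hj => hF j (by omega)
    have hle : (stage ω Λ k).time ≤ (stage ω Λ (k + 1)).time :=
      monotone_stage_time hω (Nat.le_succ k)
    have hsub : (F.filter fun r => r ≤ (stage ω Λ k).time) ⊆
        F.filter fun r => r ≤ (stage ω Λ (k + 1)).time := by
      intro r hr
      rw [Finset.mem_filter] at hr ⊢
      exact ⟨hr.1, hr.2.trans hle⟩
    rcases isMove_or_isStop hω k with ⟨z, hmove⟩ | ⟨-, -, hu, -⟩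
    · have hu := hmove.2.2.2.2
      by_cases hz : o = z
      · subst hz
        rw [hu, Function.update_self]
        refine Nat.succ_le_of_lt (h1.trans_lt (Finset.card_lt_card ?_))
        refine (Finset.ssubset_iff_of_subset hsub).2 ⟨(stage ω Λ (k + 1)).time, ?_, ?_⟩
        · exact Finset.mem_filter.2 ⟨hF k (by omega) hmove, le_rfl⟩
        · exact fun h => absurd (Finset.mem_filter.1 h).2 (not_le.2 hmove.2.2.1)
      · rw [hu, Function.update_of_ne hz]
        exact h1.trans (Finset.card_le_card hsub)
    · rw [hu]
      exact h1.trans (Finset.card_le_card hsub)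

/-- If the process fixates, then the number of topplings at a vertex is bounded over all legal
lists. -/
theorem Fixates.exists_count_le (hω : ∀ x i, Tendsto (ringTime ω x i) atTop atTop)
    (hfix : Fixates ω) (o : V) :
    ∃ C, ∀ α, Legal Set.univ 0 α (initialConfig ω, ω.2.1) → α.count o ≤ C := by
  obtain ⟨ζ, hζ, hstab⟩ := hfix
  choose T hT0 hT using hstab
  -- `Λ₀` is chosen before `α`: up to time `T o` it limits the active particles at `o` to `Λ₀.card`,
  -- so only finitely many rings can count there, whatever `α` is.
  obtain ⟨Λ₀, hΛ₀, hoΛ₀⟩ := ((hζ o (T o)).and (eventually_ge_atTop {o})).exists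
  replace hoΛ₀ : o ∈ Λ₀ := hoΛ₀ (Finset.mem_singleton_self o)
  have hfin := finite_ringSet hω o Λ₀.card (T o)
  refine ⟨hfin.toFinset.card, fun α hα => ?_⟩
  -- A time by which `o` and all sites of `α` have become stable for good.
  set t : ℝ := T o + ∑ z ∈ α.toFinset, T z with ht
  have hto : T o ≤ t := le_add_of_nonneg_right (Finset.sum_nonneg fun z _ => hT0 z)
  have ht0 : 0 ≤ t := (hT0 o).trans hto
  have htz : ∀ z ∈ α, T z ≤ t := fun z hz =>
    (Finset.single_le_sum (fun z _ => hT0 z) (List.mem_toFinset.2 hz)).trans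
      (le_add_of_nonneg_left (hT0 o))
  obtain ⟨Λ, hΛo, hΛα⟩ := ((hζ o t).and
    ((eventually_all_finset α.toFinset).2 fun z _ => hζ z t)).exists
  obtain ⟨k, hk, hk'⟩ := exists_stage_eq_finiteARW (Λ := Λ) hω ht0
  -- The dynamics in `Λ` up to time `t` stabilizes the sites of `α`. That suffices for the least
  -- action principle, even if other sites of `Λ` are still active.
  obtain ⟨β, hβ1, hβ2, hβ3⟩ := exists_legal_run_eq_stage (Λ := Λ) hω k
  have hcount := hα.count_le hβ1 (fun z hz => by
    rw [hβ2]
    change ((stage ω Λ k).config z).numActive = 0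
    rw [← hk', hΛα z (List.mem_toFinset.2 hz) t ⟨ht0, le_rfl⟩]
    exact hT z t (htz z hz)) o
  rw [hβ3] at hcount
  refine hcount.trans ((used_stage_le hω (F := hfin.toFinset) k ?_).trans
    (Finset.card_filter_le _ _))
  intro j hj hmove
  obtain ⟨-, ⟨i, hi, n, hn⟩, hlt, -⟩ := hmove
  have hjt : (stage ω Λ (j + 1)).time ≤ (t : EReal) :=
    (monotone_stage_time hω (Nat.succ_le_of_lt hj)).trans hk
  obtain ⟨s, hs0, hs⟩ := exists_stage_time_eq (Λ := Λ) hω (hlt.trans_le le_top).ne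
  rw [hn] at hlt hjt
  have hst : s < ringTime ω o i n := by rw [hs] at hlt; exact EReal.coe_lt_coe_iff.1 hlt
  have hrt : ringTime ω o i n ≤ t := EReal.coe_le_coe_iff.1 hjt
  -- Just before a move at `o` this site is active, which is impossible after `T o`.
  have hle : ringTime ω o i n ≤ T o := by
    by_contra! hgt
    have hmax : max s (T o) < ringTime ω o i n := max_lt hst hgt
    have hcfg : finiteARW ω Λ (max s (T o)) = (stage ω Λ j).config :=
      finiteARW_eq_of_time hω (by rw [hs]; exact EReal.coe_le_coe_iff.2 (le_max_left _ _))
        (by rw [hn]; exact EReal.coe_lt_coe_iff.2 hmax)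
    have h1 := hΛo (max s (T o)) ⟨hs0.trans (le_max_left _ _), (hmax.le).trans hrt⟩
    have h2 := hT o (max s (T o)) (le_max_right _ _)
    rw [← h1, hcfg] at h2
    rw [SiteState.Stable] at h2
    omega
  rw [Set.Finite.mem_toFinset]
  refine ⟨i, ?_, n, hn, hle⟩
  have hcfg : finiteARW ω Λ s = (stage ω Λ j).config :=
    finiteARW_eq_of_time hω hs.le (by rw [hn]; exact EReal.coe_lt_coe_iff.2 hst)
  have h1 := hΛo s ⟨hs0, hst.le.trans hrt⟩
  have h2 := hΛ₀ s ⟨hs0, hst.le.trans hle⟩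
  -- At time `s` the dynamics in `Λ` and in `Λ₀` both agree with `ζ` at `o`, so the bound for `Λ₀`
  -- limits the index of the clock that rings in `Λ`.
  obtain ⟨k₀, -, hk₀⟩ := exists_stage_eq_finiteARW (Λ := Λ₀) hω hs0
  have h3 := numActive_stage_le hω k₀ hoΛ₀
  rw [← hk₀, h2, ← h1, hcfg] at h3
  omega

end Dynamics

/-! ### The clocks -/

section Clocks

variable {V : Type*}

theorem tendsto_sum_range_of_frequently_one_lt {a : ℕ → ℝ} (h0 : ∀ n, 0 ≤ a n)
    (h1 : ∃ᶠ n in atTop, 1 < a n) :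
    Tendsto (fun n => ∑ k ∈ Finset.range (n + 1), a k) atTop atTop := by
  have hns : ¬ Summable a := by
    intro hs
    have h2 := hs.tendsto_atTop_zero.eventually_lt_const one_pos
    obtain ⟨n, h3, h4⟩ := (h1.and_eventually h2).exists
    linarith
  exact (tendsto_add_atTop_iff_nat 1).2 ((not_summable_iff_tendsto_nat_atTop_of_nonneg h0).1 hns)

theorem expMeasure_Iic {r : ℝ} (hr : 0 < r) {x : ℝ} (hx : 0 ≤ x) :
    expMeasure r (Set.Iic x) = ENNReal.ofReal (1 - Real.exp (-(r * x))) := by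
  have := isProbabilityMeasure_expMeasure hr
  rw [← ofReal_cdf, cdf_expMeasure_eq hr, if_pos hx]

theorem ae_frequently_one_lt {r : ℝ} (hr : 0 < r) (x : V) (i : ℕ) :
    ∀ᵐ ξ ∂(Measure.infinitePi fun _ : V × ℕ × ℕ => expMeasure r),
      ∃ᶠ n in atTop, 1 < ξ (x, i, n) := by
  have := isProbabilityMeasure_expMeasure hr
  have hp : expMeasure r (Set.Iic 1) < 1 := by
    rw [expMeasure_Iic hr zero_le_one, ← ENNReal.ofReal_one, ENNReal.ofReal_lt_ofReal_iff one_pos]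
    linarith [Real.exp_pos (-(r * 1))]
  have key : ∀ N : ℕ, ∀ᵐ ξ ∂(Measure.infinitePi fun _ : V × ℕ × ℕ => expMeasure r),
      ∃ n ≥ N, 1 < ξ (x, i, n) := by
    intro N
    rw [ae_iff]
    -- For every `m`, the event forces the `m` waiting times from index `N` on to be at most 1,
    -- which has probability p ^ m with p < 1.
    refine le_antisymm (ge_of_tendsto' (ENNReal.tendsto_pow_atTop_nhds_zero_of_lt_one hp)
      fun m => ?_) zero_le
    set s : Finset (V × ℕ × ℕ) := (Finset.range m).image fun n => (x, i, N + n) with hs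
    have hcard : s.card = m := by
      rw [hs, Finset.card_image_of_injective _ fun a c h => by simpa using h, Finset.card_range]
    calc (Measure.infinitePi fun _ : V × ℕ × ℕ => expMeasure r)
          {ξ | ¬ ∃ n ≥ N, 1 < ξ (x, i, n)}
        ≤ (Measure.infinitePi fun _ : V × ℕ × ℕ => expMeasure r)
          (Set.pi s fun _ => Set.Iic 1) := by
          refine measure_mono fun ξ hξ p hp => ?_
          obtain ⟨n, -, rfl⟩ := Finset.mem_image.1 (Finset.mem_coe.1 hp)
          by_contra h
          exact hξ ⟨N + n, Nat.le_add_right _ _, not_le.1 h⟩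
      _ = expMeasure r (Set.Iic 1) ^ m := by
          rw [Measure.infinitePi_pi _ fun _ _ => measurableSet_Iic, Finset.prod_const, hcard]
  filter_upwards [ae_all_iff.2 key] with ξ hξ
  exact frequently_atTop.2 hξ

theorem ae_tendsto_ringTime [Countable V] (G : SimpleGraph V) [G.LocallyFinite] {lam : ℝ}
    (hlam : 0 ≤ lam) (hdeg : ∀ z, 0 < G.degree z) (μ : unitInterval) :
    ∀ᵐ ω ∂sampleLaw G lam μ, ∀ x i, Tendsto (ringTime ω x i) atTop atTop := by
  have hr : 0 < 1 + lam := by linarith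
  have hexp := isProbabilityMeasure_expMeasure hr
  have hS := isProbabilityMeasure_stackLaw hlam hdeg
  set E := Measure.infinitePi fun _ : V × ℕ × ℕ => expMeasure (1 + lam) with hE
  have h0 : ∀ᵐ ξ ∂E, ∀ p, 0 ≤ ξ p := by
    refine ae_all_iff.2 fun p => ?_
    have hmp := measurePreserving_eval_infinitePi (fun _ : V × ℕ × ℕ => expMeasure (1 + lam)) p
    refine hmp.quasiMeasurePreserving.ae (p := fun y => 0 ≤ y) ?_
    rw [ae_iff]
    refine measure_mono_null (t := Set.Iic 0) (fun y hy => (not_le.1 hy).le) ?_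
    rw [expMeasure_Iic hr le_rfl]
    simp
  have h1 : ∀ᵐ ξ ∂E, ∀ x i, ∃ᶠ n in atTop, 1 < ξ (x, i, n) :=
    ae_all_iff.2 fun x => ae_all_iff.2 fun i => ae_frequently_one_lt hr x i
  have hmp : MeasurePreserving (fun ω : Sample V => ω.2.2) (sampleLaw G lam μ) E :=
    (measurePreserving_snd (μ := stackLaw G lam) (ν := E)).comp
      (measurePreserving_snd (μ := siteLaw V μ) (ν := (stackLaw G lam).prod E))
  filter_upwards [hmp.quasiMeasurePreserving.ae h0, hmp.quasiMeasurePreserving.ae h1] with ω h2 h3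
  exact fun x i => tendsto_sum_range_of_frequently_one_lt (fun n => h2 _) (h3 x i)

end Clocks

end

end ARW

/-! ### The linear bound on the critical density -/

namespace ARW

noncomputable section

open scoped Classical

/-! ### The critical density -/

section Critical

variable {V : Type*} {G : SimpleGraph V} [G.LocallyFinite]

/-- Local finiteness makes each set of endpoints of walks of a given length from `o` countable.
Countability underlies all the measurability arguments. -/
theorem countable_of_connected (hconn : G.Connected) : Countable V := by
  obtain ⟨o⟩ := hconn.nonempty
  let B : ℕ → Set V := fun n => Nat.rec {o} (fun _ S => ⋃ y ∈ S, G.neighborSet y) n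
  have hB : ∀ n, (B n).Countable := by
    intro n
    induction n with
    | zero => exact Set.countable_singleton o
    | succ n ih => exact ih.biUnion fun y _ => (Set.toFinite (G.neighborSet y)).countable
  have hwalk : ∀ (u v : V) (_ : G.Walk u v) (n : ℕ), u ∈ B n → ∃ m, v ∈ B m := by
    intro u v p
    induction p with
    | nil => exact fun n hn => ⟨n, hn⟩
    | cons h _ ih => exact fun n hn => ih (n + 1) (Set.mem_biUnion hn h)
  refine Set.countable_univ_iff.1 ((Set.countable_iUnion hB).mono fun v _ => ?_)
  obtain ⟨p⟩ := hconn.preconnected o v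
  exact Set.mem_iUnion.2 (hwalk o v p 0 rfl)

theorem criticalDensity_nonneg (G : SimpleGraph V) [G.LocallyFinite] (lam : ℝ) :
    0 ≤ criticalDensity G lam := (sInf _ : unitInterval).2.1

/-- On a transient graph the critical density is at most of the order of the sleep rate. -/
theorem criticalDensity_le [Infinite V] (hconn : G.Connected) (hvt : VertexTransitive G)
    (htr : Transient G) {lam : ℝ} (hlam : 0 < lam) (o : V)
    (hle : 2 * lam * ∑' n, walkProb G n o o ≤ 1) :
    criticalDensity G lam ≤ 2 * lam * ∑' n, walkProb G n o o := by
  have hcount := countable_of_connected hconn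
  have hdeg : ∀ z, 0 < G.degree z := fun z => hconn.preconnected.degree_pos_of_nontrivial z
  set g : ℝ := ∑' n, walkProb G n o o with hgdef
  have hg : ∀ x, ∑' n, walkProb G n x x = g := fun x => by
    obtain ⟨φ, hφ⟩ := hvt o x
    rw [hgdef]
    refine tsum_congr fun n => ?_
    rw [← hφ, walkProb_iso]
  have hd : ∀ z, G.degree z = G.degree o := fun z => by
    obtain ⟨φ, hφ⟩ := hvt o z
    rw [← hφ, φ.degree_eq]
  have hg1 : 0 < g := by
    have h := (htr o).le_tsum 0 fun n _ => walkProb_nonneg n o o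
    have h0 : walkProb G 0 o o = 1 := if_pos rfl
    rw [h0] at h
    exact one_pos.trans_le h
  let μ : unitInterval := ⟨2 * lam * g, by positivity, hle⟩
  have hpos := sampleLaw_unbounded_topplings_pos hconn hdeg htr hd hlam hg hg1 (μ := μ) rfl o
  have hact : 0 < sampleLaw G lam μ {ω | IsActive ω} := by
    -- Measurability of activity is not needed: outer measure zero already means fixation almost
    -- everywhere, which contradicts unbounded topplings.
    refine pos_iff_ne_zero.2 fun h0 => hpos.ne' ?_
    have hfix : ∀ᵐ ω ∂sampleLaw G lam μ, Fixates ω := h0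
    have hnull : ∀ᵐ ω ∂sampleLaw G lam μ,
        ¬ ∀ K, ∃ α, Legal Set.univ 0 α (initialConfig ω, ω.2.1) ∧ K ≤ α.count o := by
      filter_upwards [hfix, ae_tendsto_ringTime G hlam.le hdeg μ] with ω h1 h2 h3
      obtain ⟨C, hC⟩ := h1.exists_count_le h2 o
      obtain ⟨α, h4, h5⟩ := h3 (C + 1)
      have := hC α h4
      omega
    simpa [ae_iff] using hnull
  -- One active density bounds the infimum; monotonicity of activity in the density plays no role.
  exact sInf_le (a := μ) hact

end Critical

end

end ARW

theorem theorem1 {V : Type*} [Infinite V] (G : SimpleGraph V) [G.LocallyFinite]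
    (hconn : G.Connected) (htrans : ARW.VertexTransitive G) (htransient : ARW.Transient G) :
    Tendsto (fun lam : ℝ => ARW.criticalDensity G lam) (𝓝[>] 0) (𝓝 0) ∧
    limsup (fun lam : ℝ => ((ARW.criticalDensity G lam / lam ^ (1 / 4 : ℝ) : ℝ) : EReal))
      (𝓝[>] 0) < ⊤ ∧
    ∀ᶠ lam : ℝ in 𝓝[>] 0, ARW.criticalDensity G lam < 1 := by
  obtain ⟨o⟩ := hconn.nonempty
  set g : ℝ := ∑' n, ARW.walkProb G n o o with hg
  have hT : Tendsto (fun lam : ℝ => 2 * lam * g) (𝓝[>] 0) (𝓝 0) := by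
    have : Tendsto (fun lam : ℝ => 2 * lam * g) (𝓝 0) (𝓝 (2 * 0 * g)) :=
      Continuous.tendsto (by fun_prop) 0
    rw [mul_zero, zero_mul] at this
    exact this.mono_left nhdsWithin_le_nhds
  have hle : ∀ᶠ lam : ℝ in 𝓝[>] 0, ARW.criticalDensity G lam ≤ 2 * lam * g := by
    filter_upwards [hT.eventually_le_const one_pos, self_mem_nhdsWithin] with lam h1 h2
    exact ARW.criticalDensity_le hconn htrans htransient h2 o h1
  have hlim : Tendsto (fun lam : ℝ => ARW.criticalDensity G lam) (𝓝[>] 0) (𝓝 0) :=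
    tendsto_of_tendsto_of_tendsto_of_le_of_le' tendsto_const_nhds hT
      (Eventually.of_forall fun lam => ARW.criticalDensity_nonneg G lam) hle
  refine ⟨hlim, ?_, hlim.eventually_lt_const one_pos⟩
  refine lt_of_le_of_lt (limsup_le_of_le (a := ((2 * g : ℝ) : EReal)) (h := ?_))
    (EReal.coe_lt_top _)
  have hg0 : 0 ≤ g := tsum_nonneg fun n => ARW.walkProb_nonneg n o o
  filter_upwards [hle, self_mem_nhdsWithin,
    nhdsWithin_le_nhds (Iio_mem_nhds (one_pos : (0 : ℝ) < 1))] with lam h1 h2 h3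
  have h2 : 0 < lam := h2
  have h3 : lam < 1 := h3
  rw [EReal.coe_le_coe_iff, div_le_iff₀ (by positivity)]
  -- Near 0 the linear bound is stronger than the required power 1/4.
  have h4 : lam ≤ lam ^ (1 / 4 : ℝ) := by
    calc lam = lam ^ (1 : ℝ) := (Real.rpow_one lam).symm
      _ ≤ lam ^ (1 / 4 : ℝ) := Real.rpow_le_rpow_of_exponent_ge h2 h3.le (by norm_num)
  calc ARW.criticalDensity G lam ≤ 2 * lam * g := h1
    _ = 2 * g * lam := by ring
    _ ≤ 2 * g * lam ^ (1 / 4 : ℝ) := by gcongr
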